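/- Let $1\le n\le d$ be integers and let $P=(P_1,\dots,P_n)$ be real quadratic forms on $\mathbb{R}^d$. **Decoupling constants.** Let $C>0$ be a parameter. For $\delta\in 2^{-\mathbb{N}}=\{1,\tfrac12,\tfrac14,\dots\}$ let $\mathcal{P}(\delta)$ be the set of closed dyadic cubes $\theta=a+\delta[0,1]^d\subseteq[0,1]^d$, $a\in\delta\mathbb{Z}^d$. For such $\theta$ put $$\mathcal{U}_\theta=\bigl\{\bigl(a+\delta u,\;P(a)+\delta\,\nabla P(a)\cdot u+\delta^2 w\bigr): u\in[-C,C]^d,\ w\in[-C,C]^n\bigr\}\subset\mathbb{R}^{d+n},$$ where $\nabla P(a)\cdot u$ is the derivative of $P$ at $a$ in direction $u$. Below, $f_\theta$ always denotes an arbitrary function in $L^p(\mathbb{R}^{d+n})$ whose (distributional) Fourier transform is supported in $\mathcal{U}_\theta$. The decoupling constant $\mathrm{Dec}^p_P(\delta)$ is the smallest constant for which $$\Bigl\|\sum_{\theta\in\mathcal{P}(\delta)}f_\theta\Bigr\|_p\le \mathrm{Dec}^p_P(\delta)\Bigl(\sum_{\theta\in\mathcal{P}(\delta)}\|f_\theta\|_p^p\Bigr)^{1/p}$$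 for all such families. The same definition, with the same $C$, is used for quadratic forms on $\mathbb{R}^{d-1}$. If a hyperplane $\mathcal{H}\subset\mathbb{R}^d$ through $0$ is written as a graph $t_j=\varphi(t')$, where $t'\in\mathbb{R}^{d-1}$ consists of the other coordinates and $\varphi$ is a linear form with coefficients in $[-1,1]$ (this is always possible for some $j$), then $\mathrm{Dec}^p_{\mathcal{H}}(\delta)$ is the decoupling constant of the restricted forms $t'\mapsto P|_{t_j=\varphi(t')}$ on $\mathbb{R}^{d-1}$. **Theorem.** There is $C_0$, depending only on $P$ (hence on $d,n$), such that the following holds for every Fourier support parameter $C\ge C_0$. Let $2\le p<\infty$ and $\Lambda\in\mathbb{R}$, and assume lower-dimensional decoupling with exponent $\Lambda$: there is a constant $K$ such that every hyperplane $\mathcal{H}\subset\mathbb{R}^d$ through $0$ has a graph representation as above with $$\mathrm{Dec}^p_{\mathcal{H}}(\delta)\le K\,\delta^{-\Lambda}\qquad\text{for all }\delta\in2^{-\mathbb{N}}.$$ Then for every $\epsilon>0$ and every $\tilde C<\infty$ there is a constant $K'$ such that, for every hypersurface $\widetilde{\mathcal{H}}\subset[0,1]^d$ that is a graph $t_d=L(t')$,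 or a part of one, of a $C^2$ function $L$ on a convex set $\Omega\subseteq\mathbb{R}^{d-1}$ with nonempty interior with $\|D^rL\|\le\tilde C$ on $\Omega$ for $r=0,1,2$, for every $\delta\in2^{-\mathbb{N}}$, and for all functions $f_\Box$, $\Box\in\mathcal{P}(\delta)$, as above, $$\Bigl\|\sum_{\Box\in\mathcal{P}(\delta),\ \Box\cap\widetilde{\mathcal{H}}\ne\emptyset}f_\Box\Bigr\|_p\le K'\,\delta^{-\Lambda-\epsilon}\Bigl(\sum_{\Box\in\mathcal{P}(\delta),\ \Box\cap\widetilde{\mathcal{H}}\ne\emptyset}\|f_\Box\|_p^p\Bigr)^{1/p}.$$ The constant $K'$ does not depend on $\widetilde{\mathcal{H}}$, $\delta$ or the functions $f_\Box$. -/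

import Mathlib

open MeasureTheory Set
open scoped ENNReal SchwartzMap FourierTransform

noncomputable section

namespace QuadDecoupling

/-- The dyadic scale `δ = 2⁻ᵏ`. -/
def scale (k : ℕ) : ℝ := ((2 : ℝ) ^ k)⁻¹

/-- Index set of the dyadic cubes of side length `2⁻ᵏ` contained in `[0,1]ᵈ`. -/
abbrev CubeIndex (d k : ℕ) : Type := Fin d → Fin (2 ^ k)

/-- The lower corner `a = 2⁻ᵏ i` of the dyadic cube with index `i`. -/
def corner {d k : ℕ} (i : CubeIndex d k) : Fin d → ℝ := fun l => scale k * ((i l : ℕ) : ℝ)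

/-- The closed dyadic cube `a + δ [0,1]ᵈ` with index `i`, where `δ = 2⁻ᵏ`. -/
def cube {d k : ℕ} (i : CubeIndex d k) : Set (Fin d → ℝ) :=
  Icc (corner i) (fun l => corner i l + scale k)

/-- The dyadic cubes of side length `2⁻ᵏ` in `[0,1]ᵈ` that meet the set `S`. -/
def cubesMeeting {d : ℕ} (k : ℕ) (S : Set (Fin d → ℝ)) : Finset (CubeIndex d k) :=
  open scoped Classical in Finset.univ.filter fun i => (cube i ∩ S).Nonempty

/-- The Euclidean space `ℝᵈ⁺ⁿ = ℝᵈ × ℝⁿ`. -/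
abbrev Space (d n : ℕ) : Type := EuclideanSpace ℝ (Fin d ⊕ Fin n)

/-- The parallelepiped `U_θ = (a, P(a)) + L_θ* ([-C, C]ᵈ⁺ⁿ)` of the cube `θ = a + δ [0,1]ᵈ`, where
`L_θ* (u, w) = (δ u, δ ∇P(a) · u + δ² w)`.  For a quadratic form `Q` the directional derivative
`∇Q(a) · u` is the polar form `Q (a + u) - Q a - Q u`. -/
def uncertaintyBox {d n k : ℕ} (P : Fin n → QuadraticForm ℝ (Fin d → ℝ)) (C : ℝ)
    (i : CubeIndex d k) : Set (Space d n) :=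
  {ξ | ∃ (u : Fin d → ℝ) (w : Fin n → ℝ), (∀ l, |u l| ≤ C) ∧ (∀ j, |w j| ≤ C) ∧
    (∀ l, ξ (Sum.inl l) = corner i l + scale k * u l) ∧
    ∀ j, ξ (Sum.inr j) = P j (corner i) + scale k * QuadraticMap.polar (P j) (corner i) u
      + scale k ^ 2 * w j}

/-- The Fourier transform of `f ∈ Lᵖ`, a tempered distribution, is supported in the set `U`. -/
def HasFourierSupportIn {d n : ℕ} {p : ℝ≥0∞} [Fact (1 ≤ p)]
    (f : Lp ℂ p (volume : Measure (Space d n))) (U : Set (Space d n)) : Prop :=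
  Distribution.dsupport (𝓕 (Lp.toTemperedDistribution f) : 𝓢'(Space d n, ℂ)) ⊆ U

/-- The decoupling inequality
`‖∑_{θ ∈ s} f_θ‖_p ≤ A (∑_{θ ∈ s} ‖f_θ‖_p ^ p) ^ (1/p)` for the family `s` of dyadic cubes of side
length `2⁻ᵏ` and all functions `f_θ` whose Fourier support is in `U_θ`. -/
def DecouplesWith {d n : ℕ} (P : Fin n → QuadraticForm ℝ (Fin d → ℝ)) (C : ℝ) (p : ℝ≥0∞)
    [Fact (1 ≤ p)] (k : ℕ) (s : Finset (CubeIndex d k)) (A : ℝ) : Prop :=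
  ∀ f : CubeIndex d k → Lp ℂ p (volume : Measure (Space d n)),
    (∀ i, HasFourierSupportIn (f i) (uncertaintyBox P C i)) →
      ‖∑ i ∈ s, f i‖ ≤ A * (∑ i ∈ s, ‖f i‖ ^ p.toReal) ^ (1 / p.toReal)

/-- The decoupling constant at scale `δ = 2⁻ᵏ` of the quadratic forms `P`: the smallest constant in
the decoupling inequality for all dyadic cubes of side length `δ` in `[0,1]ᵈ`. -/
def decouplingConst {d n : ℕ} (P : Fin n → QuadraticForm ℝ (Fin d → ℝ)) (C : ℝ) (p : ℝ≥0∞)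
    [Fact (1 ≤ p)] (k : ℕ) : ℝ :=
  sInf {A : ℝ | 0 ≤ A ∧ DecouplesWith P C p k Finset.univ A}

/-- The infimum defining the decoupling constant is attained. -/
theorem decouplingConst_isLeast {d n : ℕ} (P : Fin n → QuadraticForm ℝ (Fin d → ℝ)) (C : ℝ)
    (p : ℝ≥0∞) [Fact (1 ≤ p)] (hp : p ≠ ⊤) (k : ℕ) :
    IsLeast {A : ℝ | 0 ≤ A ∧ DecouplesWith P C p k Finset.univ A} (decouplingConst P C p k) := by
  have hp1 : (1 : ℝ) ≤ p.toReal := by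
    have h := (ENNReal.toReal_le_toReal ENNReal.one_ne_top hp).2 (Fact.out : 1 ≤ p)
    simpa using h
  have hp0 : 0 < p.toReal := by linarith
  have hne : {A : ℝ | 0 ≤ A ∧ DecouplesWith P C p k Finset.univ A}.Nonempty := by
    refine ⟨(Finset.univ : Finset (CubeIndex d k)).card, by positivity, fun f _ => ?_⟩
    refine (norm_sum_le _ _).trans ?_
    rw [← nsmul_eq_mul]
    refine Finset.sum_le_card_nsmul _ _ _ fun i _ => ?_
    have h1 : ‖f i‖ ^ p.toReal ≤ ∑ i, ‖f i‖ ^ p.toReal :=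
      Finset.single_le_sum (f := fun i => ‖f i‖ ^ p.toReal) (fun j _ => by positivity)
        (Finset.mem_univ i)
    have h2 := Real.rpow_le_rpow (by positivity) h1 (by positivity : 0 ≤ 1 / p.toReal)
    rwa [← Real.rpow_mul (norm_nonneg _), mul_one_div_cancel hp0.ne', Real.rpow_one] at h2
  have hcl : IsClosed {A : ℝ | 0 ≤ A ∧ DecouplesWith P C p k Finset.univ A} := by
    refine isClosed_Ici.inter ?_
    have h : {A : ℝ | DecouplesWith P C p k Finset.univ A} =
        ⋂ (f : CubeIndex d k → Lp ℂ p (volume : Measure (Space d n)))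
          (_ : ∀ i, HasFourierSupportIn (f i) (uncertaintyBox P C i)),
          {A : ℝ | ‖∑ i, f i‖ ≤ A * (∑ i, ‖f i‖ ^ p.toReal) ^ (1 / p.toReal)} := by
      ext A
      simp [DecouplesWith]
    change IsClosed {A : ℝ | DecouplesWith P C p k Finset.univ A}
    rw [h]
    refine isClosed_iInter fun f => isClosed_iInter fun _ => ?_
    exact isClosed_le continuous_const (continuous_id.mul continuous_const)
  exact hcl.isLeast_csInf hne ⟨0, fun A hA => hA.1⟩

/-- The linear parametrization `t' ↦ (t', φ(t'))` of a hyperplane through the origin in `ℝᵐ⁺¹`, where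
the value `φ(t')` is the coordinate with index `j`, and `t'` holds the other coordinates in order. -/
def graphMap {m : ℕ} (j : Fin (m + 1)) (φ : (Fin m → ℝ) →ₗ[ℝ] ℝ) :
    (Fin m → ℝ) →ₗ[ℝ] (Fin (m + 1) → ℝ) :=
  LinearMap.pi (Fin.insertNth (α := fun _ => (Fin m → ℝ) →ₗ[ℝ] ℝ) j φ LinearMap.proj)

/-- Lower-dimensional decoupling with exponent `Λ`, uniformly in the hyperplane: there is a constant
`K` such that every hyperplane `H` through `0` is a graph `t_j = φ(t')` of a linear form `φ` with
coefficients at most `1` in absolute value, for which the quadratic forms `t' ↦ P(t', φ(t'))` have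
decoupling constant at most `K δ ^ (-Λ)` for all dyadic `δ`. -/
def LowerDimDecoupling {m n : ℕ} (P : Fin n → QuadraticForm ℝ (Fin (m + 1) → ℝ)) (C : ℝ)
    (p : ℝ≥0∞) [Fact (1 ≤ p)] (Λ : ℝ) : Prop :=
  ∃ K : ℝ, ∀ H : Submodule ℝ (Fin (m + 1) → ℝ), Module.finrank ℝ H = m →
    ∃ (j : Fin (m + 1)) (φ : (Fin m → ℝ) →ₗ[ℝ] ℝ),
      (∀ l, |φ (Pi.single l 1)| ≤ 1) ∧ LinearMap.range (graphMap j φ) = H ∧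
      ∀ k : ℕ, decouplingConst (fun l => (P l).comp (graphMap j φ)) C p k ≤ K * scale k ^ (-Λ)

/-- The set `S ⊆ ℝᵐ⁺¹` is (part of) a graph `t_d = L(t')`, `d = m + 1`, of a function `L` of class
`C²` on a convex domain `Ω ⊆ ℝᵐ` with nonempty interior, whose `C²` norm
`max_{r ≤ 2} sup_Ω ‖Dʳ L‖` is at most `M`. -/
def IsC2Graph {m : ℕ} (M : ℝ) (S : Set (Fin (m + 1) → ℝ)) : Prop :=
  ∃ (Ω : Set (EuclideanSpace ℝ (Fin m))) (L : EuclideanSpace ℝ (Fin m) → ℝ),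
    Convex ℝ Ω ∧ (interior Ω).Nonempty ∧ ContDiffOn ℝ 2 L Ω ∧
    (∀ x ∈ Ω, ∀ r : ℕ, r ≤ 2 → ‖iteratedFDerivWithin ℝ r L Ω x‖ ≤ M) ∧
    ∀ t ∈ S, WithLp.toLp 2 (Fin.init t : Fin m → ℝ) ∈ Ω ∧
      t (Fin.last m) = L (WithLp.toLp 2 (Fin.init t : Fin m → ℝ))

end QuadDecoupling

end

/-! The proof has an analytic half and a geometric half.

The analytic half is `decoupling_transfer`: a decoupling inequality for frequency regions passes,
with the same constant, to all regions that an affine surjection maps into them. Restricting a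
function to translates of the dual subspace projects its Fourier support, so the inequality holds on
almost every slice and Fubini integrates its `p`-th power. Applied to the affine symmetries of the
graph of `P`, this gives parabolic rescaling (`DecouplesWith.norm_sum_le_of_parent_eq`). Applied to
a shear that also forgets one coordinate, it lets the restricted forms decouple cubes lying near a
hyperplane (`IsPlanar.norm_sum_le`).

The geometric half is two inductions on scale. For a hyperplane
(`exists_decouplesWith_of_isPlanar`), small cubes are decoupled into ancestors of a fixed side `2⁻ʳ`
by the lower-dimensional hypothesis; each ancestor is rescaled to the unit cube, where its
descendants again lie near a parallel hyperplane. Each round costs a constant factor, which a large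
`r` absorbs into `2 ^ (r ε)`.

For a `C²` graph (`LowerDimDecoupling.exists_decouplesWith_cubesMeeting`), a fixed number `l` of
generations is removed at a time. In a cube of side `2⁻ʳ` with `r ≥ l`, the graph deviates from a
tangent plane by `O(2⁻²ʳ)`, hence by `O(2⁻ʳ⁻ˡ)`, so its descendants of side `2⁻ʳ⁻ˡ` form a planar
family (`IsC2Graph.exists_isPlanar`). Rescaling and the hyperplane case decouple them, and a large
`l` absorbs the constant. Uniformity over hyperplanes is essential, because the tangent plane varies
from cube to cube. -/

noncomputable section

namespace QuadDecoupling

open Distribution Filter Topology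

/-! ### Supports of tempered distributions and compactly supported test functions. -/

section Distributions

variable {E : Type*} [NormedAddCommGroup E] [NormedSpace ℝ E] [FiniteDimensional ℝ E]

/-- A tempered distribution annihilates the compactly supported test functions whose support
is disjoint from the support of the distribution. -/
theorem apply_eq_zero_of_disjoint_dsupport (T : 𝓢'(E, ℂ)) (g : 𝓢(E, ℂ))
    (hg : HasCompactSupport g) (hd : Disjoint (tsupport g) (dsupport T)) : T g = 0 := by
  classical
  have h1 : ∀ x : E, x ∈ tsupport g → ∃ s : Set E, IsVanishingOn T s ∧ IsOpen s ∧ x ∈ s := by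
    intro x hx
    exact (notMem_dsupport_iff x).1 (Set.disjoint_left.1 hd hx)
  choose! s hsv hso hxs using h1
  have hK : IsCompact (tsupport g) := hg
  -- Finitely many open sets on which `T` vanishes cover the support of `g`; a subordinate partition
  -- of unity splits `g` into pieces, each killed by `T`.
  obtain ⟨t, hts, htc⟩ := hK.elim_nhds_subcover s fun x hx => (hso x hx).mem_nhds (hxs x hx)
  obtain ⟨ρ, hρ⟩ := SmoothPartitionOfUnity.exists_isSubordinate (modelWithCornersSelf ℝ E)
    (isClosed_tsupport g) (fun i : t => s i) (fun i => hso i (hts i i.2)) (by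
      intro x hx
      obtain ⟨i, hi, hxi⟩ := Set.mem_iUnion₂.1 (htc hx)
      exact Set.mem_iUnion.2 ⟨⟨i, hi⟩, hxi⟩)
  have hsm : ∀ i : t, ContDiff ℝ (⊤ : ℕ∞) fun x => ((ρ i x : ℝ) : ℂ) * g x := by
    intro i
    refine ContDiff.mul (Complex.ofRealCLM.contDiff.comp ?_) (g.smooth _)
    exact (ρ i).contMDiff.contDiff
  have hcs : ∀ i : t, HasCompactSupport fun x => ((ρ i x : ℝ) : ℂ) * g x := fun i => hg.mul_left
  have hsum : g = ∑ i : t, (hcs i).toSchwartzMap (hsm i) := by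
    ext x
    rw [sum_apply]
    change g x = ∑ i : t, ((ρ i x : ℝ) : ℂ) * g x
    rw [← Finset.sum_mul]
    by_cases hx : x ∈ tsupport g
    · have := ρ.sum_eq_one hx
      rw [finsum_eq_sum_of_fintype] at this
      rw [← Complex.ofReal_sum, this]; simp
    · simp [image_eq_zero_of_notMem_tsupport hx]
  rw [hsum, map_sum]
  refine Finset.sum_eq_zero fun i _ => hsv i (hts i i.2) _ ?_
  refine Subset.trans ?_ (hρ i)
  refine closure_mono fun x hx => ?_
  simp only [Function.mem_support] at hx ⊢
  intro h0
  apply hx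
  change ((ρ i x : ℝ) : ℂ) * g x = 0
  simp [h0]

/-- The support of a tempered distribution is contained in a closed set as soon as the
distribution annihilates the compactly supported test functions living off that set. -/
theorem dsupport_subset_of_forall (T : 𝓢'(E, ℂ)) {U : Set E} (hU : IsClosed U)
    (h : ∀ g : 𝓢(E, ℂ), HasCompactSupport g → Disjoint (tsupport g) U → T g = 0) :
    dsupport T ⊆ U := by
  intro x hx
  by_contra hxU
  obtain ⟨r, hr, hrU⟩ := Metric.isOpen_iff.1 hU.isOpen_compl x hxU
  refine (mem_dsupport_iff_not_isVanishingOn x).1 hx (Metric.ball x r) (Metric.mem_ball_self hr)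
    Metric.isOpen_ball ?_
  intro u hu
  refine h u ?_ ?_
  · exact (isCompact_closedBall x r).of_isClosed_subset (isClosed_tsupport u)
      (hu.trans Metric.ball_subset_closedBall)
  · exact Set.disjoint_left.2 fun y hy => hrU (hu hy)

theorem dsupport_sum_subset {ι : Type*} (s : Finset ι) (T : ι → 𝓢'(E, ℂ)) {U : Set E}
    (hU : IsClosed U) (h : ∀ i ∈ s, dsupport (T i) ⊆ U) : dsupport (∑ i ∈ s, T i : 𝓢'(E, ℂ)) ⊆ U := by
  refine dsupport_subset_of_forall _ hU fun g hg hd => ?_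
  have h1 : (∑ i ∈ s, T i) g = ∑ i ∈ s, T i g := by
    induction s using Finset.cons_induction with
    | empty => rfl
    | cons a s ha ih =>
      rw [Finset.sum_cons, Finset.sum_cons, ← ih fun i hi => h i (Finset.mem_cons_of_mem hi)]
      rfl
  rw [h1]
  exact Finset.sum_eq_zero fun i hi =>
    apply_eq_zero_of_disjoint_dsupport _ _ hg (hd.mono_right (h i hi))

/-- Compactly supported test functions are dense, so they detect tempered distributions. -/
theorem eq_zero_of_forall_hasCompactSupport (T : 𝓢'(E, ℂ))
    (h : ∀ g : 𝓢(E, ℂ), HasCompactSupport g → T g = 0) : T = 0 := by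
  let χ : ContDiffBump (0 : E) := ⟨1, 2, one_pos, one_lt_two⟩
  have hχs : ContDiff ℝ (⊤ : ℕ∞) fun x => ((χ x : ℝ) : ℂ) :=
    Complex.ofRealCLM.contDiff.comp χ.contDiff
  have hχc : HasCompactSupport fun x => ((χ x : ℝ) : ℂ) :=
    χ.hasCompactSupport.comp_left (g := fun t : ℝ => (t : ℂ)) (by simp)
  let X : 𝓢(E, ℂ) := hχc.toSchwartzMap hχs
  have hX : ∀ x, X x = ((χ x : ℝ) : ℂ) := fun x => rfl
  -- The truncation error of `g` at radius `1 / a` is `v (a • x) * g x` up to sign.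
  let v : E → ℂ := fun x => 1 - X x
  have hv : ContDiff ℝ (⊤ : ℕ∞) v := contDiff_const.sub (X.smooth _)
  have hvb : ∀ i : ℕ, ∃ c : ℝ, 0 ≤ c ∧ ∀ x, ‖iteratedFDeriv ℝ i v x‖ ≤ c := by
    intro i
    refine ⟨1 + SchwartzMap.seminorm ℝ 0 i X, by positivity, fun x => ?_⟩
    have h1 : iteratedFDeriv ℝ i v x
        = iteratedFDeriv ℝ i (fun _ : E => (1 : ℂ)) x - iteratedFDeriv ℝ i X x := by
      have := iteratedFDeriv_sub_apply (𝕜 := ℝ) (i := i) (x := x) (f := fun _ : E => (1 : ℂ))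
        (g := X) contDiffAt_const (X.contDiffAt _)
      exact this
    rw [h1]
    refine (norm_sub_le _ _).trans (add_le_add ?_ ?_)
    · rcases Nat.eq_zero_or_pos i with rfl | hi
      · simp
      · rw [iteratedFDeriv_const_of_ne hi.ne']; simp
    · exact SchwartzMap.norm_iteratedFDeriv_le_seminorm ℝ X i x
  choose c hc0 hc using hvb
  ext g
  change T g = 0
  let a : ℕ → ℝ := fun N => 1 / ((N : ℝ) + 1)
  have ha0 : ∀ N, 0 < a N := fun N => by positivity
  have ha1 : ∀ N, a N ≤ 1 := fun N => by
    rw [div_le_one (by positivity)]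
    have : (0 : ℝ) ≤ N := by positivity
    linarith
  -- The error factor vanishes near `x` when `a N * ‖x‖ < 1`; otherwise `1 ≤ a N * ‖x‖`. The gain `a
  -- N` is thus paid for by one extra power of `‖x‖`, hence by the Schwartz seminorm of index `k +
  -- 1`.
  have hvle : ∀ N i x, ‖iteratedFDeriv ℝ i (fun y => v (a N • y)) x‖ ≤ c i * (a N * ‖x‖) := by
    intro N i x
    by_cases hx : a N * ‖x‖ < 1
    · have h0 : (fun y => v (a N • y)) =ᶠ[𝓝 x] fun _ => (0 : ℂ) := by
        have hcont : Continuous fun y : E => a N * ‖y‖ := by fun_prop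
        filter_upwards [hcont.continuousAt.eventually (gt_mem_nhds hx)] with y hy
        have : χ (a N • y) = 1 := by
          apply χ.one_of_mem_closedBall
          rw [mem_closedBall_zero_iff, norm_smul, Real.norm_of_nonneg (ha0 N).le]
          exact hy.le
        simp only [v, hX, this]; simp
      rw [(h0.iteratedFDeriv ℝ i).eq_of_nhds]
      have : iteratedFDeriv ℝ i (fun _ : E => (0 : ℂ)) x = 0 := by
        rcases Nat.eq_zero_or_pos i with rfl | hi
        · ext; simp
        · rw [iteratedFDeriv_const_of_ne hi.ne']; rfl
      rw [this, norm_zero]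
      have := hc0 i
      have := (ha0 N).le
      positivity
    · push Not at hx
      rw [iteratedFDeriv_comp_const_smul (a N) (hv.of_le (by exact_mod_cast le_top))]
      rw [norm_smul, norm_pow, Real.norm_of_nonneg (ha0 N).le]
      calc a N ^ i * ‖iteratedFDeriv ℝ i v (a N • x)‖ ≤ 1 * c i := by
            gcongr
            · exact pow_le_one₀ (ha0 N).le (ha1 N)
            · exact hc i _
        _ ≤ c i * (a N * ‖x‖) := by
            rw [one_mul]; exact le_mul_of_one_le_right (hc0 i) hx
  have hcsm : ∀ N, ContDiff ℝ (⊤ : ℕ∞) fun x => X (a N • x) * g x := fun N =>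
    ((X.smooth _).comp (contDiff_const_smul (a N))).mul (g.smooth _)
  have hcs : ∀ N, HasCompactSupport fun x => X (a N • x) * g x := fun N => by
    have h1 : HasCompactSupport fun x => X (a N • x) :=
      hχc.comp_homeomorph (Homeomorph.smulOfNeZero (a N) (ha0 N).ne')
    exact h1.mul_right
  let gN : ℕ → 𝓢(E, ℂ) := fun N => (hcs N).toSchwartzMap (hcsm N)
  have hlim : Tendsto gN atTop (𝓝 g) := by
    rw [(schwartz_withSeminorms ℝ E ℂ).tendsto_nhds]
    rintro ⟨k, n⟩ ε hε
    set M : ℝ := ∑ i ∈ Finset.range (n + 1),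
      (n.choose i : ℝ) * c i * SchwartzMap.seminorm ℝ (k + 1) (n - i) g with hM
    have hM0 : 0 ≤ M := Finset.sum_nonneg fun i _ => by
      have := hc0 i
      positivity
    have hle : ∀ N, SchwartzMap.seminorm ℝ k n (gN N - g) ≤ a N * M := by
      intro N
      refine SchwartzMap.seminorm_le_bound ℝ k n _ (mul_nonneg (ha0 N).le hM0) fun x => ?_
      have h1 : (⇑(gN N - g) : E → ℂ) = fun y => v (a N • y) * (-g) y := by
        ext y
        change X (a N • y) * g y - g y = (1 - X (a N • y)) * (- g y)
        ring
      rw [h1]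
      have h2 := norm_iteratedFDeriv_mul_le (𝕜 := ℝ) (N := ((⊤ : ℕ∞) : WithTop ℕ∞))
        (hv.comp (contDiff_const_smul (a N))) ((-g).smooth _) x (n := n)
        (by exact_mod_cast le_top)
      refine (mul_le_mul_of_nonneg_left h2 (by positivity)).trans ?_
      rw [hM, Finset.mul_sum, Finset.mul_sum]
      refine Finset.sum_le_sum fun i _ => ?_
      have h3 := hvle N i x
      have h4 := SchwartzMap.le_seminorm ℝ (k + 1) (n - i) (-g) x
      rw [map_neg_eq_map] at h4
      calc ‖x‖ ^ k * ((n.choose i : ℝ) * ‖iteratedFDeriv ℝ i (fun y => v (a N • y)) x‖ *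
              ‖iteratedFDeriv ℝ (n - i) (⇑(-g)) x‖)
          ≤ ‖x‖ ^ k * ((n.choose i : ℝ) * (c i * (a N * ‖x‖)) *
              ‖iteratedFDeriv ℝ (n - i) (⇑(-g)) x‖) := by gcongr
        _ = a N * ((n.choose i : ℝ) * c i *
              (‖x‖ ^ (k + 1) * ‖iteratedFDeriv ℝ (n - i) (⇑(-g)) x‖)) := by ring
        _ ≤ _ := by
            have := hc0 i
            have := (ha0 N).le
            gcongr
    have hlim0 : Tendsto (fun N => a N * M) atTop (𝓝 0) := by
      have := (tendsto_one_div_add_atTop_nhds_zero_nat (𝕜 := ℝ)).mul_const M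
      rwa [zero_mul] at this
    filter_upwards [hlim0.eventually (gt_mem_nhds hε)] with N hN
    exact (hle N).trans_lt hN
  have hT : Tendsto (fun N => T (gN N)) atTop (𝓝 (T g)) :=
    ((map_continuous T).tendsto g).comp hlim
  have h0 : ∀ N, T (gN N) = 0 := fun N => h _ (hcs N)
  simp only [h0] at hT
  exact tendsto_nhds_unique hT tendsto_const_nhds

end Distributions

/-! ### Linear changes of variables for Haar measures. -/

section Haar

variable {E E' : Type*} [NormedAddCommGroup E] [NormedSpace ℝ E] [FiniteDimensional ℝ E]
  [MeasurableSpace E] [BorelSpace E] [NormedAddCommGroup E'] [NormedSpace ℝ E']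
  [FiniteDimensional ℝ E'] [MeasurableSpace E'] [BorelSpace E']

omit [FiniteDimensional ℝ E] in
theorem exists_map_eq_smul (L : E ≃L[ℝ] E') (μ : Measure E) [μ.IsAddHaarMeasure]
    (ν : Measure E') [ν.IsAddHaarMeasure] :
    ∃ c : NNReal, c ≠ 0 ∧ μ.map L = c • ν := by
  have : (μ.map L).IsAddHaarMeasure := L.isAddHaarMeasure_map μ
  refine ⟨_, ?_, Measure.isAddLeftInvariant_eq_smul (μ.map L) ν⟩
  exact (Measure.addHaarScalarFactor_pos_of_isAddHaarMeasure (μ.map L) ν).ne'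

omit [FiniteDimensional ℝ E] [FiniteDimensional ℝ E'] in
theorem measurableEmbedding_continuousLinearEquiv (L : E ≃L[ℝ] E') : MeasurableEmbedding L :=
  L.toHomeomorph.measurableEmbedding

end Haar

/-! ### Fourier supports of slices of an `Lᵖ` function. -/

section Slices

variable {E F G : Type*}
  [NormedAddCommGroup E] [InnerProductSpace ℝ E] [FiniteDimensional ℝ E] [MeasurableSpace E]
  [BorelSpace E]
  [NormedAddCommGroup F] [InnerProductSpace ℝ F] [FiniteDimensional ℝ F] [MeasurableSpace F]
  [BorelSpace F]
  [NormedAddCommGroup G] [InnerProductSpace ℝ G] [FiniteDimensional ℝ G] [MeasurableSpace G]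
  [BorelSpace G]

-- In the splitting `D` the test function `ψ` is a translate of `g` tensored with `h`, so its
-- transform factors in the dual coordinates `B`. The translation by `η` becomes a modulation, and
-- `c` is the Jacobian of `D`.
open Real in
theorem exists_fourier_tensor (B : (F × G) ≃L[ℝ] E) (D : E ≃L[ℝ] (F × G))
    (hBD : ∀ x z ξ, inner ℝ (B (x, z)) ξ = inner ℝ x (D ξ).1 + inner ℝ z (D ξ).2) (η : F) :
    ∃ c : ℂ, c ≠ 0 ∧ ∀ (g : 𝓢(F, ℂ)) (h : 𝓢(G, ℂ)) (ψ : 𝓢(E, ℂ)),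
      (∀ ξ, ψ ξ = g ((D ξ).1 + η) * h (D ξ).2) →
      ∀ x z, 𝓕 ψ (B (x, z)) = c * ((𝐞 (inner ℝ η x) • 𝓕 g x) * 𝓕 h z) := by
  obtain ⟨c, hc, hmap⟩ := exists_map_eq_smul D (volume : Measure E)
    ((volume : Measure F).prod (volume : Measure G))
  refine ⟨(c : ℂ), by exact_mod_cast hc, fun g h ψ hψ x z => ?_⟩
  rw [SchwartzMap.fourier_coe, SchwartzMap.fourier_coe, SchwartzMap.fourier_coe,
    Real.fourier_eq, Real.fourier_eq, Real.fourier_eq]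
  have h1 : (fun ξ => 𝐞 (-inner ℝ ξ (B (x, z))) • ψ ξ) = fun ξ =>
      (fun y : F × G => (𝐞 (-inner ℝ y.1 x) • g (y.1 + η)) * (𝐞 (-inner ℝ y.2 z) • h y.2)) (D ξ) := by
    ext ξ
    rw [real_inner_comm, hBD, hψ, neg_add, AddChar.map_add_eq_mul]
    simp only [Circle.smul_def, Circle.coe_mul, real_inner_comm, smul_eq_mul]
    ring
  rw [h1, ← (measurableEmbedding_continuousLinearEquiv D).integral_map (μ := volume)
    (fun y : F × G => (𝐞 (-inner ℝ y.1 x) • g (y.1 + η)) * (𝐞 (-inner ℝ y.2 z) • h y.2))]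
  rw [hmap, integral_smul_nnreal_measure, integral_prod_mul (fun u => 𝐞 (-inner ℝ u x) • g (u + η)) (fun w => 𝐞 (-inner ℝ w z) • h w),
    NNReal.smul_def, Complex.real_smul]
  congr 2
  simp only [Circle.smul_def, smul_eq_mul]
  rw [← integral_sub_right_eq_self _ η, ← integral_const_mul]
  congr 1
  ext u
  simp only [sub_add_cancel, inner_sub_left]
  rw [neg_sub, sub_eq_add_neg, AddChar.map_add_eq_mul, Circle.coe_mul]
  ring

open Real in
/-- The restriction of `f` to a translate of a linear subspace, modulated by `η`. -/
def slice (B : (F × G) ≃L[ℝ] E) (η : F) (f : E → ℂ) (z : G) (x : F) : ℂ :=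
  𝐞 (inner ℝ η x) • f (B (x, z))

theorem enorm_slice (B : (F × G) ≃L[ℝ] E) (η : F) (f : E → ℂ) (z : G) (x : F) :
    ‖slice B η f z x‖ₑ = ‖f (B (x, z))‖ₑ := by
  rw [slice, ← ofReal_norm, ← ofReal_norm, Circle.norm_smul]

theorem stronglyMeasurable_slice (B : (F × G) ≃L[ℝ] E) (η : F) {f : E → ℂ}
    (hf : StronglyMeasurable f) :
    StronglyMeasurable fun y : F × G => slice B η f y.2 y.1 := by
  unfold slice
  simp only [Circle.smul_def, smul_eq_mul]
  refine StronglyMeasurable.mul ?_ (hf.comp_measurable B.continuous.measurable)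
  exact Continuous.stronglyMeasurable (by fun_prop)

theorem lintegral_lintegral_slice (B : (F × G) ≃L[ℝ] E) (η : F) {f : E → ℂ}
    (hf : StronglyMeasurable f) {c : NNReal}
    (hc : ((volume : Measure F).prod (volume : Measure G)).map B = c • (volume : Measure E))
    (r : ℝ) :
    ∫⁻ z : G, ∫⁻ x : F, ‖slice B η f z x‖ₑ ^ r = c * ∫⁻ y, ‖f y‖ₑ ^ r := by
  have h1 : AEMeasurable (fun y : F × G => ‖slice B η f y.2 y.1‖ₑ ^ r)
      ((volume : Measure F).prod (volume : Measure G)) :=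
    ((stronglyMeasurable_slice B η hf).measurable.enorm.pow_const r).aemeasurable
  rw [← lintegral_prod_symm _ h1]
  simp only [enorm_slice]
  rw [← (measurableEmbedding_continuousLinearEquiv B).lintegral_map (fun y => ‖f y‖ₑ ^ r), hc,
    lintegral_smul_measure]
  rfl

theorem eLpNorm_rpow_eq_lintegral {α : Type*} [MeasurableSpace α] {μ : Measure α} {p : ℝ≥0∞}
    (hp0 : p ≠ 0) (hp : p ≠ ⊤) (f : α → ℂ) :
    eLpNorm f p μ ^ p.toReal = ∫⁻ x, ‖f x‖ₑ ^ p.toReal ∂μ := by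
  have := ENNReal.toReal_pos hp0 hp
  rw [eLpNorm_eq_lintegral_rpow_enorm_toReal hp0 hp, ← ENNReal.rpow_mul, one_div,
    inv_mul_cancel₀ this.ne', ENNReal.rpow_one]

theorem ae_memLp_slice (B : (F × G) ≃L[ℝ] E) (η : F) {p : ℝ≥0∞} (hp0 : p ≠ 0) (hp : p ≠ ⊤)
    {f : E → ℂ} (hf : StronglyMeasurable f) (hfp : MemLp f p) :
    ∀ᵐ z : G, MemLp (slice B η f z) p := by
  obtain ⟨c, -, hc⟩ := exists_map_eq_smul B
    ((volume : Measure F).prod (volume : Measure G)) (volume : Measure E)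
  have h1 := lintegral_lintegral_slice B η hf hc p.toReal
  have h2 : ∫⁻ z : G, ∫⁻ x : F, ‖slice B η f z x‖ₑ ^ p.toReal ≠ ⊤ := by
    rw [h1, ← eLpNorm_rpow_eq_lintegral hp0 hp]
    exact ENNReal.mul_ne_top (by simp)
      (ENNReal.rpow_ne_top_of_nonneg (by positivity) hfp.eLpNorm_ne_top)
  have hsm := stronglyMeasurable_slice B η hf
  have h3 : Measurable fun z : G => ∫⁻ x : F, ‖slice B η f z x‖ₑ ^ p.toReal :=
    Measurable.lintegral_prod_left' (hsm.measurable.enorm.pow_const p.toReal)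
  filter_upwards [ae_lt_top h3 h2] with z hz
  refine ⟨(hsm.comp_measurable measurable_prodMk_right).aestronglyMeasurable, ?_⟩
  rw [← eLpNorm_rpow_eq_lintegral hp0 hp] at hz
  exact (ENNReal.rpow_lt_top_iff_of_pos (ENNReal.toReal_pos hp0 hp)).1 hz

/-- If `f ∈ Lᵖ` has Fourier support off the cylinder over the support of the test function `g`,
then almost every slice of `f` pairs to zero with the Fourier transform of `g`. -/
theorem ae_integral_fourier_mul_slice_eq_zero (B : (F × G) ≃L[ℝ] E) (D : E ≃L[ℝ] (F × G))
    (hBD : ∀ x z ξ, inner ℝ (B (x, z)) ξ = inner ℝ x (D ξ).1 + inner ℝ z (D ξ).2) (η : F)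
    {p : ℝ≥0∞} [Fact (1 ≤ p)] (hp : p ≠ ⊤) (f : Lp ℂ p (volume : Measure E))
    (g : 𝓢(F, ℂ)) (hg : HasCompactSupport g)
    (hfg : ∀ ξ ∈ dsupport (𝓕 (Lp.toTemperedDistribution f) : 𝓢'(E, ℂ)),
      (D ξ).1 + η ∉ tsupport g) :
    ∀ᵐ z : G, ∫ x, 𝓕 g x * slice B η f z x = 0 := by
  have hp1 : 1 ≤ p := Fact.out
  have hp0 : p ≠ 0 := (zero_lt_one.trans_le hp1).ne'
  have hpr : 0 < p.toReal := ENNReal.toReal_pos hp0 hp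
  have hf : StronglyMeasurable f := Lp.stronglyMeasurable f
  have hsm := stronglyMeasurable_slice B η hf
  obtain ⟨c, hc0, hc⟩ := exists_map_eq_smul B
    ((volume : Measure F).prod (volume : Measure G)) (volume : Measure E)
  set q : ℝ≥0∞ := (1 - p⁻¹)⁻¹ with hq
  have hpq : ENNReal.HolderConjugate p q := ENNReal.HolderConjugate.inv_one_sub_inv' hp1
  have hq1 : Fact (1 ≤ q) := by simp [hq, fact_iff]
  let k : G → ℂ := fun z => ∫ x, 𝓕 g x * slice B η f z x
  have hkm : StronglyMeasurable k := by
    refine StronglyMeasurable.integral_prod_left (μ := (volume : Measure F))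
      (f := fun x z => 𝓕 g x * slice B η f z x) ?_
    exact ((𝓕 g : 𝓢(F, ℂ)).continuous.stronglyMeasurable.comp_measurable measurable_fst).mul hsm
  have hkle : ∀ z, ‖k z‖ₑ ≤ eLpNorm (𝓕 g : 𝓢(F, ℂ)) q * eLpNorm (slice B η f z) p := by
    intro z
    refine (enorm_integral_le_lintegral_enorm _).trans ?_
    rw [← eLpNorm_one_eq_lintegral_enorm]
    have := hpq.symm
    exact eLpNorm_smul_le_mul_eLpNorm (p := q) (q := p) (r := 1)
      (f := slice B η f z) (φ := (𝓕 g : 𝓢(F, ℂ)))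
      (hsm.comp_measurable measurable_prodMk_right).aestronglyMeasurable
      (𝓕 g : 𝓢(F, ℂ)).continuous.aestronglyMeasurable
  -- Hölder in `x` bounds `k z` by the `Lᵖ` norm of the slice, and Tonelli makes the `p`-th power of
  -- that norm integrable in `z`.
  have hkp : MemLp k p := by
    refine ⟨hkm.aestronglyMeasurable, ?_⟩
    rw [← ENNReal.rpow_lt_top_iff_of_pos hpr, eLpNorm_rpow_eq_lintegral hp0 hp]
    calc ∫⁻ z, ‖k z‖ₑ ^ p.toReal
        ≤ ∫⁻ z, eLpNorm (𝓕 g : 𝓢(F, ℂ)) q ^ p.toReal * ∫⁻ x, ‖slice B η f z x‖ₑ ^ p.toReal := by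
          refine lintegral_mono fun z => ?_
          rw [← eLpNorm_rpow_eq_lintegral hp0 hp, ← ENNReal.mul_rpow_of_nonneg _ _ hpr.le]
          exact ENNReal.rpow_le_rpow (hkle z) hpr.le
      _ < ⊤ := by
          rw [lintegral_const_mul _
            (Measurable.lintegral_prod_left' (hsm.measurable.enorm.pow_const p.toReal)),
            lintegral_lintegral_slice B η hf hc, ← eLpNorm_rpow_eq_lintegral hp0 hp]
          have h1 := ((𝓕 g : 𝓢(F, ℂ)).memLp q).eLpNorm_ne_top
          have h2 := (Lp.memLp f).eLpNorm_ne_top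
          exact (ENNReal.mul_ne_top (ENNReal.rpow_ne_top_of_nonneg hpr.le h1)
            (ENNReal.mul_ne_top (by simp) (ENNReal.rpow_ne_top_of_nonneg hpr.le h2))).lt_top
  obtain ⟨c', hc'0, hc'⟩ := exists_fourier_tensor B D hBD η
  -- Pairing the transform of `k` with `h` amounts, up to a nonzero factor, to pairing the transform
  -- of `f` with the tensor `ψ`, whose support misses the Fourier support of `f`. So `k` vanishes as
  -- a distribution, hence almost everywhere.
  have hT : (𝓕 (Lp.toTemperedDistribution hkp.toLp) : 𝓢'(G, ℂ)) = 0 := by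
    refine eq_zero_of_forall_hasCompactSupport _ fun h hh => ?_
    have hψs : ContDiff ℝ (⊤ : ℕ∞) fun ξ => g ((D ξ).1 + η) * h (D ξ).2 := by
      have h1 : ContDiff ℝ (⊤ : ℕ∞) fun ξ => (D ξ).1 + η :=
        (contDiff_fst.comp D.contDiff).add contDiff_const
      have h2 : ContDiff ℝ (⊤ : ℕ∞) fun ξ => (D ξ).2 := contDiff_snd.comp D.contDiff
      exact ((g.smooth _).comp h1).mul ((h.smooth _).comp h2)
    have hψc : HasCompactSupport fun ξ => g ((D ξ).1 + η) * h (D ξ).2 := by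
      have hK : IsCompact (D.symm '' (((fun u => u - η) '' tsupport g) ×ˢ tsupport h)) :=
        ((hg.isCompact.image (by fun_prop)).prod hh.isCompact).image D.symm.continuous
      refine HasCompactSupport.intro hK fun ξ hξ => ?_
      by_contra h0
      refine hξ ⟨D ξ, ⟨⟨(D ξ).1 + η, subset_tsupport _ (left_ne_zero_of_mul h0), by simp⟩,
        subset_tsupport _ (right_ne_zero_of_mul h0)⟩, by simp⟩
    let ψ : 𝓢(E, ℂ) := hψc.toSchwartzMap hψs
    have hψ : ∀ ξ, ψ ξ = g ((D ξ).1 + η) * h (D ξ).2 := fun ξ => rfl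
    have hψt : tsupport ψ ⊆ {ξ | (D ξ).1 + η ∈ tsupport g} := by
      refine closure_minimal (fun ξ hξ => ?_) ((isClosed_tsupport g).preimage (by fun_prop))
      exact subset_tsupport _ (left_ne_zero_of_mul hξ)
    have h0 : (𝓕 (Lp.toTemperedDistribution f) : 𝓢'(E, ℂ)) ψ = 0 :=
      apply_eq_zero_of_disjoint_dsupport _ ψ hψc
        (Set.disjoint_left.2 fun ξ h1 h2 => hfg ξ h2 (hψt h1))
    rw [TemperedDistribution.fourier_apply, Lp.toTemperedDistribution_apply] at h0 ⊢
    have hint : Integrable (fun y => 𝓕 ψ y • f y) (volume : Measure E) := by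
      have := hpq.symm
      have h1 : MemLp ((fun y => 𝓕 ψ y) • (f : E → ℂ)) 1 (volume : Measure E) :=
        (Lp.memLp f).smul ((𝓕 ψ : 𝓢(E, ℂ)).memLp q)
      exact memLp_one_iff_integrable.1 h1
    have hintB : Integrable (fun y : F × G => 𝓕 ψ (B y) • f (B y))
        ((volume : Measure F).prod (volume : Measure G)) := by
      refine ((measurableEmbedding_continuousLinearEquiv B).integrable_map_iff
        (g := fun y => 𝓕 ψ y • f y)).1 ?_
      rw [hc]
      exact hint.smul_measure (by simp)
    have hB : ∫ y : F × G, 𝓕 ψ (B y) • f (B y)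
        ∂((volume : Measure F).prod (volume : Measure G)) = 0 := by
      rw [← (measurableEmbedding_continuousLinearEquiv B).integral_map
        (fun y => 𝓕 ψ y • f y), hc, integral_smul_nnreal_measure, h0, smul_zero]
    rw [integral_prod_symm _ hintB] at hB
    have hk : ∀ z : G, ∫ x : F, 𝓕 ψ (B (x, z)) • f (B (x, z)) = c' * (𝓕 h z * k z) := by
      intro z
      change _ = c' * (𝓕 h z * ∫ x, _)
      rw [← integral_const_mul, ← integral_const_mul]
      congr 1
      ext x
      rw [hc' g h ψ hψ, slice]
      simp only [Circle.smul_def, smul_eq_mul]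
      ring
    simp only [hk] at hB
    rw [integral_const_mul] at hB
    rw [← (mul_eq_zero.1 hB).resolve_left hc'0]
    refine integral_congr_ae ?_
    filter_upwards [hkp.coeFn_toLp] with z hz
    rw [hz, smul_eq_mul]
  have hT' : Lp.toTemperedDistribution hkp.toLp = (0 : 𝓢'(G, ℂ)) := by
    have h1 := congrArg (fun S : 𝓢'(G, ℂ) => 𝓕⁻ S) hT
    simpa using h1
  have hker : hkp.toLp ∈ (Lp.toTemperedDistributionCLM ℂ (volume : Measure G) p).ker := hT'
  rw [Lp.ker_toTemperedDistributionCLM_eq_bot, Submodule.mem_bot] at hker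
  filter_upwards [hkp.coeFn_toLp, (Lp.eq_zero_iff_ae_eq_zero.1 hker)] with z h1 h2
  rw [h1] at h2
  exact h2

/-- Vanishing for one test function is known only off a null set of slices depending on that
function. Countably many test functions must therefore suffice. -/
theorem exists_countable_subset_determining {X : Type*} [TopologicalSpace X]
    [SecondCountableTopology X] (A : Set X) :
    ∃ S ⊆ A, S.Countable ∧ ∀ L : X → ℂ, Continuous L → (∀ v ∈ S, L v = 0) → ∀ v ∈ A, L v = 0 := by
  obtain ⟨S, hSc, hSd⟩ := TopologicalSpace.exists_countable_dense A
  refine ⟨Subtype.val '' S, by rintro _ ⟨v, -, rfl⟩; exact v.2, hSc.image _, ?_⟩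
  intro L hL h v hv
  have hclosed : IsClosed {v : A | L v.1 = 0} :=
    isClosed_eq (hL.comp continuous_subtype_val) continuous_const
  have huniv := hclosed.closure_subset_iff.2 fun v hv => h _ ⟨v, hv, rfl⟩
  rw [hSd.closure_eq] at huniv
  exact huniv (Set.mem_univ (⟨v, hv⟩ : A))

theorem exists_continuous_toLp_eq_integral {p q : ℝ≥0∞} [Fact (1 ≤ p)] [Fact (1 ≤ q)]
    [ENNReal.HolderConjugate p q] {u : F → ℂ} (hu : MemLp u p) :
    ∃ L : Lp ℂ q (volume : Measure F) → ℂ, Continuous L ∧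
      ∀ h : 𝓢(F, ℂ), L (h.toLp q) = ∫ x, h x * u x := by
  refine ⟨((ContinuousLinearMap.lsmul ℂ ℂ (E := ℂ)).flip.lpPairing volume p q) hu.toLp,
    ContinuousLinearMap.continuous _, fun h => ?_⟩
  rw [ContinuousLinearMap.lpPairing_eq_integral]
  refine integral_congr_ae ?_
  filter_upwards [hu.coeFn_toLp, h.coeFn_toLp q volume] with x hx hh
  simp [hx, hh]

/-- Almost every slice of a function in `Lᵖ` has Fourier support in the projection of the Fourier
support of the function. -/
theorem ae_dsupport_slice_subset (B : (F × G) ≃L[ℝ] E) (D : E ≃L[ℝ] (F × G))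
    (hBD : ∀ x z ξ, inner ℝ (B (x, z)) ξ = inner ℝ x (D ξ).1 + inner ℝ z (D ξ).2) (η : F)
    {p : ℝ≥0∞} [Fact (1 ≤ p)] (hp1 : 1 < p) (hp : p ≠ ⊤) (f : Lp ℂ p (volume : Measure E))
    {W : Set F} (hW : IsClosed W)
    (hfW : ∀ ξ ∈ dsupport (𝓕 (Lp.toTemperedDistribution f) : 𝓢'(E, ℂ)), (D ξ).1 + η ∈ W) :
    ∀ᵐ z : G, ∀ hm : MemLp (slice B η f z) p,
      dsupport (𝓕 (Lp.toTemperedDistribution hm.toLp) : 𝓢'(F, ℂ)) ⊆ W := by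
  -- `1 < p` makes the conjugate exponent finite, so that `L^q` is second countable.
  obtain ⟨q, hq1, hqt, hpq⟩ : ∃ q : ℝ≥0∞, Fact (1 ≤ q) ∧ Fact (q ≠ ⊤) ∧
      ENNReal.HolderConjugate p q := by
    refine ⟨(1 - p⁻¹)⁻¹, by simp [fact_iff], ⟨ENNReal.inv_ne_top.2 ?_⟩,
      ENNReal.HolderConjugate.inv_one_sub_inv' hp1.le⟩
    exact (tsub_pos_of_lt (ENNReal.inv_lt_one.2 hp1)).ne'
  let A : Set (Lp ℂ q (volume : Measure F)) :=
    {v | ∃ g : 𝓢(F, ℂ), HasCompactSupport g ∧ Disjoint (tsupport g) W ∧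
      (𝓕 g : 𝓢(F, ℂ)).toLp q = v}
  obtain ⟨S, hSA, hSc, hS⟩ := exists_countable_subset_determining A
  have hSz : ∀ᵐ z : G, ∀ v ∈ S, ∃ g : 𝓢(F, ℂ), (𝓕 g : 𝓢(F, ℂ)).toLp q = v ∧
      ∫ x, 𝓕 g x * slice B η f z x = 0 := by
    rw [ae_ball_iff hSc]
    intro v hv
    obtain ⟨g, hg, hd, hgv⟩ := hSA hv
    filter_upwards [ae_integral_fourier_mul_slice_eq_zero B D hBD η hp f g hg
      fun ξ hξ => Set.disjoint_right.1 hd (hfW ξ hξ)] with z hz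
    exact ⟨g, hgv, hz⟩
  filter_upwards [hSz] with z hz hm
  refine dsupport_subset_of_forall _ hW fun g hg hd => ?_
  obtain ⟨L, hLc, hL⟩ := exists_continuous_toLp_eq_integral (q := q) hm
  rw [TemperedDistribution.fourier_apply, Lp.toTemperedDistribution_apply]
  have h1 : L ((𝓕 g : 𝓢(F, ℂ)).toLp q) = 0 := by
    refine hS L hLc (fun v hv => ?_) _ ⟨g, hg, hd, rfl⟩
    obtain ⟨g', rfl, h0⟩ := hz v hv
    rw [hL]
    exact h0
  rw [hL] at h1
  rw [← h1]
  refine integral_congr_ae ?_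
  filter_upwards [hm.coeFn_toLp] with x hx
  rw [hx, smul_eq_mul]

end Slices

/-! ### Transfer of decoupling inequalities along affine surjections. -/

section Transfer

variable {E F G : Type*}
  [NormedAddCommGroup E] [InnerProductSpace ℝ E] [FiniteDimensional ℝ E] [MeasurableSpace E]
  [BorelSpace E]
  [NormedAddCommGroup F] [InnerProductSpace ℝ F] [FiniteDimensional ℝ F] [MeasurableSpace F]
  [BorelSpace F]
  [NormedAddCommGroup G] [InnerProductSpace ℝ G] [FiniteDimensional ℝ G] [MeasurableSpace G]
  [BorelSpace G]

theorem lintegral_enorm_rpow_eq_ofReal_norm {α : Type*} [MeasurableSpace α] {μ : Measure α}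
    {p : ℝ≥0∞} (hp0 : p ≠ 0) (hp : p ≠ ⊤) (f : Lp ℂ p μ) :
    ∫⁻ x, ‖f x‖ₑ ^ p.toReal ∂μ = ENNReal.ofReal (‖f‖ ^ p.toReal) := by
  rw [← eLpNorm_rpow_eq_lintegral hp0 hp, Lp.norm_def,
    ENNReal.toReal_rpow, ENNReal.ofReal_toReal]
  exact ENNReal.rpow_ne_top_of_nonneg ENNReal.toReal_nonneg (Lp.eLpNorm_ne_top f)

/-- The `p`-th power form is the one that integrates over slices and adds over disjoint subfamilies.
-/
theorem rpow_le_of_le_mul_rpow {a b A r : ℝ} (hr : 0 < r) (ha : 0 ≤ a) (hb : 0 ≤ b) (hA : 0 ≤ A) :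
    a ≤ A * b ^ (1 / r) ↔ a ^ r ≤ A ^ r * b := by
  have h1 : (A * b ^ (1 / r)) ^ r = A ^ r * b := by
    rw [Real.mul_rpow hA (by positivity), ← Real.rpow_mul hb, one_div_mul_cancel hr.ne',
      Real.rpow_one]
  rw [← h1, Real.rpow_le_rpow_iff ha (by positivity) hr]

/-- Decoupling for slices implies decoupling. -/
theorem decoupling_of_slices (B : (F × G) ≃L[ℝ] E) (D : E ≃L[ℝ] (F × G))
    (hBD : ∀ x z ξ, inner ℝ (B (x, z)) ξ = inner ℝ x (D ξ).1 + inner ℝ z (D ξ).2) (η : F)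
    {p : ℝ≥0∞} [Fact (1 ≤ p)] (hp1 : 1 < p) (hp : p ≠ ⊤)
    {ι : Type*} (s : Finset ι) (W : ι → Set F) (hW : ∀ i ∈ s, IsClosed (W i)) {A : ℝ} (hA : 0 ≤ A)
    (hdec : ∀ g : ι → Lp ℂ p (volume : Measure F),
      (∀ i ∈ s, dsupport (𝓕 (Lp.toTemperedDistribution (g i)) : 𝓢'(F, ℂ)) ⊆ W i) →
      ‖∑ i ∈ s, g i‖ ≤ A * (∑ i ∈ s, ‖g i‖ ^ p.toReal) ^ (1 / p.toReal))
    (f : ι → Lp ℂ p (volume : Measure E))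
    (hf : ∀ i ∈ s, ∀ ξ ∈ dsupport (𝓕 (Lp.toTemperedDistribution (f i)) : 𝓢'(E, ℂ)),
      (D ξ).1 + η ∈ W i) :
    ‖∑ i ∈ s, f i‖ ≤ A * (∑ i ∈ s, ‖f i‖ ^ p.toReal) ^ (1 / p.toReal) := by
  classical
  have hp0 : p ≠ 0 := (zero_lt_one.trans hp1).ne'
  have hpr : 0 < p.toReal := ENNReal.toReal_pos hp0 hp
  obtain ⟨c, hc0, hc⟩ := exists_map_eq_smul B
    ((volume : Measure F).prod (volume : Measure G)) (volume : Measure E)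
  have hsm : ∀ i, StronglyMeasurable (f i) := fun i => Lp.stronglyMeasurable (f i)
  let fs : E → ℂ := fun y => ∑ i ∈ s, f i y
  have hfs : StronglyMeasurable fs := Finset.stronglyMeasurable_fun_sum s fun i _ => hsm i
  have hslice : ∀ z x, slice B η fs z x = ∑ i ∈ s, slice B η (f i) z x := by
    intro z x
    simp only [slice, fs, Finset.smul_sum]
  have hmem : ∀ᵐ z : G, ∀ i ∈ s, MemLp (slice B η (f i) z) p :=
    (ae_ball_iff s.countable_toSet).2 fun i _ =>
      ae_memLp_slice B η hp0 hp (hsm i) (Lp.memLp (f i))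
  have hsupp : ∀ᵐ z : G, ∀ i ∈ s, ∀ hm : MemLp (slice B η (f i) z) p,
      dsupport (𝓕 (Lp.toTemperedDistribution hm.toLp) : 𝓢'(F, ℂ)) ⊆ W i :=
    (ae_ball_iff s.countable_toSet).2 fun i hi =>
      ae_dsupport_slice_subset B D hBD η hp1 hp (f i) (hW i hi) (hf i hi)
  have hz : ∀ᵐ z : G, ∫⁻ x, ‖slice B η fs z x‖ₑ ^ p.toReal ≤
      ENNReal.ofReal (A ^ p.toReal) * ∑ i ∈ s, ∫⁻ x, ‖slice B η (f i) z x‖ₑ ^ p.toReal := by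
    filter_upwards [hmem, hsupp] with z hm hs
    let g : ι → Lp ℂ p (volume : Measure F) := fun i =>
      if h : MemLp (slice B η (f i) z) p then h.toLp else 0
    have hg : ∀ i (h : i ∈ s), g i = (hm i h).toLp := fun i h => dif_pos (hm i h)
    have hgc : ∀ i ∈ s, g i =ᵐ[volume] slice B η (f i) z := fun i h => by
      rw [hg i h]
      exact (hm i h).coeFn_toLp
    have h1 := hdec g fun i hi => by
      rw [hg i hi]
      exact hs i hi (hm i hi)
    rw [rpow_le_of_le_mul_rpow hpr (norm_nonneg _)
      (Finset.sum_nonneg fun i _ => by positivity) hA] at h1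
    have h2 := ENNReal.ofReal_le_ofReal h1
    rw [ENNReal.ofReal_mul (by positivity),
      ENNReal.ofReal_sum_of_nonneg (fun i _ => by positivity),
      ← lintegral_enorm_rpow_eq_ofReal_norm hp0 hp] at h2
    simp only [← lintegral_enorm_rpow_eq_ofReal_norm hp0 hp] at h2
    have h3 : ∫⁻ x, ‖slice B η fs z x‖ₑ ^ p.toReal
        = ∫⁻ x, ‖(∑ i ∈ s, g i : Lp ℂ p (volume : Measure F)) x‖ₑ ^ p.toReal := by
      refine lintegral_congr_ae ?_
      filter_upwards [Lp.coeFn_finsetSum s g,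
        (ae_ball_iff s.countable_toSet).2 hgc] with x hx hx'
      rw [hx, hslice, Finset.sum_apply, Finset.sum_congr rfl hx']
    have h4 : ∀ i ∈ s, ∫⁻ x, ‖slice B η (f i) z x‖ₑ ^ p.toReal
        = ∫⁻ x, ‖g i x‖ₑ ^ p.toReal := by
      intro i hi
      refine lintegral_congr_ae ?_
      filter_upwards [hgc i hi] with x hx
      rw [hx]
    rw [h3, Finset.sum_congr rfl h4]
    exact h2
  have hint := lintegral_mono_ae hz
  have hmeas : ∀ i, Measurable fun z : G => ∫⁻ x, ‖slice B η (f i) z x‖ₑ ^ p.toReal := fun i =>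
    Measurable.lintegral_prod_left'
      ((stronglyMeasurable_slice B η (hsm i)).measurable.enorm.pow_const p.toReal)
  rw [lintegral_const_mul _ (Finset.measurable_fun_sum _ fun i _ => hmeas i),
    lintegral_finsetSum _ fun i _ => hmeas i, lintegral_lintegral_slice B η hfs hc] at hint
  simp only [lintegral_lintegral_slice B η (hsm _) hc] at hint
  rw [← Finset.mul_sum, mul_left_comm, ENNReal.mul_le_mul_iff_right (by simpa using hc0) (by simp)]
    at hint
  have h5 : ∫⁻ y, ‖fs y‖ₑ ^ p.toReal
      = ∫⁻ y, ‖(∑ i ∈ s, f i : Lp ℂ p (volume : Measure E)) y‖ₑ ^ p.toReal := by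
    refine lintegral_congr_ae ?_
    filter_upwards [Lp.coeFn_finsetSum s f] with x hx
    rw [hx, Finset.sum_apply]
  rw [h5] at hint
  simp only [lintegral_enorm_rpow_eq_ofReal_norm hp0 hp] at hint
  rw [← ENNReal.ofReal_sum_of_nonneg (fun i _ => by positivity),
    ← ENNReal.ofReal_mul (by positivity), ENNReal.ofReal_le_ofReal_iff (by positivity)] at hint
  exact (rpow_le_of_le_mul_rpow hpr (norm_nonneg _)
    (Finset.sum_nonneg fun i _ => by positivity) hA).2 hint

omit [MeasurableSpace E] [BorelSpace E] [MeasurableSpace F] [BorelSpace F] [MeasurableSpace G]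
  [BorelSpace G] in
/-- The physical-space coordinates dual to a splitting of frequency space. -/
theorem exists_dual_continuousLinearEquiv (D : E ≃L[ℝ] (F × G)) :
    ∃ B : (F × G) ≃L[ℝ] E,
      ∀ x z ξ, inner ℝ (B (x, z)) ξ = inner ℝ x (D ξ).1 + inner ℝ z (D ξ).2 := by
  let D₁ : E →ₗ[ℝ] F := LinearMap.fst ℝ F G ∘ₗ (D : E →ₗ[ℝ] F × G)
  let D₂ : E →ₗ[ℝ] G := LinearMap.snd ℝ F G ∘ₗ (D : E →ₗ[ℝ] F × G)
  let b : (F × G) →ₗ[ℝ] E := (LinearMap.adjoint D₁).coprod (LinearMap.adjoint D₂)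
  have hb : ∀ x z ξ, inner ℝ (b (x, z)) ξ = inner ℝ x (D ξ).1 + inner ℝ z (D ξ).2 := by
    intro x z ξ
    simp only [b, LinearMap.coprod_apply, inner_add_left, LinearMap.adjoint_inner_left]
    rfl
  have hinj : Function.Injective b := by
    rw [← LinearMap.ker_eq_bot, LinearMap.ker_eq_bot']
    rintro ⟨x, z⟩ h
    have h1 := hb x z (D.symm (x, z))
    rw [h, inner_zero_left, D.apply_symm_apply, real_inner_self_eq_norm_sq,
      real_inner_self_eq_norm_sq] at h1
    have hx : ‖x‖ ^ 2 = 0 := by nlinarith [sq_nonneg ‖x‖, sq_nonneg ‖z‖]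
    have hz : ‖z‖ ^ 2 = 0 := by nlinarith [sq_nonneg ‖x‖, sq_nonneg ‖z‖]
    simpa using And.intro hx hz
  refine ⟨(LinearEquiv.ofInjectiveOfFinrankEq b hinj
    D.toLinearEquiv.finrank_eq.symm).toContinuousLinearEquiv, hb⟩

/-- Decoupling inequalities transfer from frequency regions `W i` to any frequency regions
that an affine surjection `ξ ↦ π ξ + η` maps to the `W i`. -/
theorem decoupling_transfer (π : E →ₗ[ℝ] F) (hπ : Function.Surjective π) (η : F)
    {p : ℝ≥0∞} [Fact (1 ≤ p)] (hp1 : 1 < p) (hp : p ≠ ⊤)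
    {ι : Type*} (s : Finset ι) (W : ι → Set F) (hW : ∀ i ∈ s, IsClosed (W i)) {A : ℝ} (hA : 0 ≤ A)
    (hdec : ∀ g : ι → Lp ℂ p (volume : Measure F),
      (∀ i ∈ s, dsupport (𝓕 (Lp.toTemperedDistribution (g i)) : 𝓢'(F, ℂ)) ⊆ W i) →
      ‖∑ i ∈ s, g i‖ ≤ A * (∑ i ∈ s, ‖g i‖ ^ p.toReal) ^ (1 / p.toReal))
    (f : ι → Lp ℂ p (volume : Measure E))
    (hf : ∀ i ∈ s, ∀ ξ ∈ dsupport (𝓕 (Lp.toTemperedDistribution (f i)) : 𝓢'(E, ℂ)),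
      π ξ + η ∈ W i) :
    ‖∑ i ∈ s, f i‖ ≤ A * (∑ i ∈ s, ‖f i‖ ^ p.toReal) ^ (1 / p.toReal) := by
  -- The map `π` is completed to an isomorphism by the orthogonal projection onto its kernel; the
  -- first component of `D` is `π` itself.
  let D : E ≃L[ℝ] (F × LinearMap.ker π) := (LinearMap.equivProdOfSurjectiveOfIsCompl π
    ((LinearMap.ker π).orthogonalProjectionOnto : E →ₗ[ℝ] LinearMap.ker π)
    (LinearMap.range_eq_top.2 hπ)
    (LinearMap.range_eq_top.2 fun x =>
      ⟨x, Submodule.orthogonalProjectionOnto_mem_subspace_eq_self x⟩)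
    (by
      have h : LinearMap.ker ((LinearMap.ker π).orthogonalProjectionOnto :
        E →ₗ[ℝ] LinearMap.ker π) = (LinearMap.ker π)ᗮ := Submodule.ker_orthogonalProjectionOnto
      rw [h]
      exact Submodule.isCompl_orthogonal _)).toContinuousLinearEquiv
  obtain ⟨B, hBD⟩ := exists_dual_continuousLinearEquiv D
  exact decoupling_of_slices B D hBD η hp1 hp s W hW hA hdec f hf

end Transfer

/-! ### Arithmetic of dyadic scales. -/

section Scale

theorem scale_pos (k : ℕ) : 0 < scale k := by unfold scale; positivity

theorem scale_le_one (k : ℕ) : scale k ≤ 1 := by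
  unfold scale
  exact inv_le_one_of_one_le₀ (one_le_pow₀ one_le_two)

theorem scale_add (r l : ℕ) : scale (r + l) = scale r * scale l := by
  unfold scale
  rw [pow_add, mul_inv]

theorem scale_mul_two_pow (k : ℕ) : scale k * 2 ^ k = 1 := by
  unfold scale
  exact inv_mul_cancel₀ (by positivity)

theorem scale_anti {k l : ℕ} (h : k ≤ l) : scale l ≤ scale k := by
  unfold scale
  gcongr
  norm_num

theorem tendsto_scale : Tendsto scale atTop (𝓝 0) := by
  have : scale = fun k => (1 / 2 : ℝ) ^ k := by
    ext k
    rw [scale, one_div, inv_pow]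
  rw [this]
  exact tendsto_pow_atTop_nhds_zero_of_lt_one (by norm_num) (by norm_num)

theorem exists_scale_mul_le (a : ℝ) {b : ℝ} (hb : 0 < b) : ∃ N, ∀ l, N ≤ l → scale l * a ≤ b := by
  have h : Tendsto (fun l => scale l * a) atTop (𝓝 0) := by
    simpa using tendsto_scale.mul_const a
  obtain ⟨N, hN⟩ := eventually_atTop.1 (h.eventually (gt_mem_nhds hb))
  exact ⟨N, fun l hl => (hN l hl).le⟩

theorem exists_mul_scale_rpow_le_one (a : ℝ) {ε : ℝ} (hε : 0 < ε) :
    ∃ N, ∀ l, N ≤ l → a * scale l ^ ε ≤ 1 := by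
  have h : Tendsto (fun l => a * scale l ^ ε) atTop (𝓝 0) := by
    have h1 := (tendsto_scale.rpow_const (p := ε) (Or.inr hε.le)).const_mul a
    rwa [Real.zero_rpow hε.ne', mul_zero] at h1
  obtain ⟨N, hN⟩ := eventually_atTop.1 (h.eventually (gt_mem_nhds one_pos))
  exact ⟨N, fun l hl => (hN l hl).le⟩

end Scale

/-! ### Dyadic ancestors and relative positions. -/

section Cubes

variable {d r l : ℕ}

/-- The dyadic cube of side length `2⁻ʳ` that contains the given one. -/
def parent (i : CubeIndex d (r + l)) : CubeIndex d r := fun x =>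
  ⟨(i x : ℕ) / 2 ^ l, Nat.div_lt_of_lt_mul (by
    exact (i x).2.trans_eq (by rw [pow_add, mul_comm]))⟩

/-- The position of a dyadic cube in its parent, rescaled to the unit cube. -/
def relIndex (i : CubeIndex d (r + l)) : CubeIndex d l := fun x =>
  ⟨(i x : ℕ) % 2 ^ l, Nat.mod_lt _ (by positivity)⟩

/-- The dyadic cube with the given parent and relative position. -/
def childIndex (τ : CubeIndex d r) (e : CubeIndex d l) : CubeIndex d (r + l) := fun x =>
  ⟨2 ^ l * (τ x : ℕ) + e x, by
    have h1 := (τ x).2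
    have h2 := (e x).2
    calc 2 ^ l * (τ x : ℕ) + e x < 2 ^ l * (τ x : ℕ) + 2 ^ l := by omega
      _ = 2 ^ l * ((τ x : ℕ) + 1) := by ring
      _ ≤ 2 ^ l * 2 ^ r := Nat.mul_le_mul_left _ h1
      _ = 2 ^ (r + l) := by rw [pow_add, mul_comm]⟩

theorem childIndex_parent_relIndex (i : CubeIndex d (r + l)) :
    childIndex (parent i) (relIndex i) = i := by
  ext x
  exact Nat.div_add_mod _ _

theorem corner_eq_parent_add (i : CubeIndex d (r + l)) :
    corner i = corner (parent i) + scale r • corner (relIndex i) := by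
  ext x
  simp only [corner, parent, relIndex, Pi.add_apply, Pi.smul_apply, smul_eq_mul]
  have h1 : ((i x : ℕ) : ℝ) = 2 ^ l * (((i x : ℕ) / 2 ^ l : ℕ) : ℝ) + (((i x : ℕ) % 2 ^ l : ℕ) : ℝ) := by
    exact_mod_cast (Nat.div_add_mod (i x : ℕ) (2 ^ l)).symm
  rw [h1, scale_add]
  linear_combination (scale r * (((i x : ℕ) / 2 ^ l : ℕ) : ℝ)) * scale_mul_two_pow l

theorem corner_nonneg {k : ℕ} (i : CubeIndex d k) (x : Fin d) : 0 ≤ corner i x := by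
  unfold corner
  have := scale_pos k
  positivity

theorem corner_add_scale_le_one {k : ℕ} (i : CubeIndex d k) (x : Fin d) :
    corner i x + scale k ≤ 1 := by
  unfold corner
  have h1 : ((i x : ℕ) : ℝ) + 1 ≤ 2 ^ k := by exact_mod_cast (i x).2
  have := scale_pos k
  have h2 := scale_mul_two_pow k
  nlinarith

theorem norm_corner_le_one {k : ℕ} (i : CubeIndex d k) : ‖corner i‖ ≤ 1 := by
  rw [pi_norm_le_iff_of_nonneg zero_le_one]
  intro x
  rw [Real.norm_of_nonneg (corner_nonneg i x)]
  have := corner_add_scale_le_one i x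
  have := scale_pos k
  linarith

theorem cube_subset_cube_parent (i : CubeIndex d (r + l)) : cube i ⊆ cube (parent i) := by
  intro y hy
  have h1 := corner_eq_parent_add i
  have h0 := scale_pos r
  constructor
  · intro x
    have h2 := hy.1 x
    rw [h1] at h2
    simp only [Pi.add_apply, Pi.smul_apply, smul_eq_mul] at h2
    have h3 := corner_nonneg (relIndex i) x
    nlinarith
  · intro x
    have h2 := hy.2 x
    rw [h1] at h2
    simp only [Pi.add_apply, Pi.smul_apply, smul_eq_mul, scale_add] at h2
    have h3 := corner_add_scale_le_one (relIndex i) x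
    change y x ≤ corner (parent i) x + scale r
    nlinarith

end Cubes

/-! ### Uncertainty boxes and affine symmetries of the graph of `P`. -/

section Forms

variable {d n : ℕ}

theorem exists_quadraticForm_bound (P : Fin n → QuadraticForm ℝ (Fin d → ℝ)) :
    ∃ c : ℝ, 0 ≤ c ∧ (∀ j x, |P j x| ≤ c * ‖x‖ ^ 2) ∧
      ∀ j x y, |QuadraticMap.polar (P j) x y| ≤ 2 * c * ‖x‖ * ‖y‖ := by
  have h1 : ∀ j, ∃ c : ℝ, 0 ≤ c ∧ ∀ x y, |QuadraticMap.polar (P j) x y| ≤ c * ‖x‖ * ‖y‖ := by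
    intro j
    let L : (Fin d → ℝ) →L[ℝ] (Fin d → ℝ) →L[ℝ] ℝ := LinearMap.toContinuousLinearMap
      ((LinearMap.toContinuousLinearMap : ((Fin d → ℝ) →ₗ[ℝ] ℝ) ≃ₗ[ℝ] _).toLinearMap ∘ₗ
        (P j).polarBilin)
    exact ⟨‖L‖, L.opNorm_nonneg, fun x y => L.le_opNorm₂ x y⟩
  choose c hc0 hc using h1
  have hle : ∀ j, c j ≤ ∑ j, c j := fun j =>
    Finset.single_le_sum (fun j _ => hc0 j) (Finset.mem_univ j)
  have hpol : ∀ j x y, |QuadraticMap.polar (P j) x y| ≤ (∑ j, c j) * ‖x‖ * ‖y‖ := fun j x y =>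
    (hc j x y).trans (by gcongr; exact hle j)
  refine ⟨(∑ j, c j) / 2, ?_, fun j x => ?_, fun j x y => (hpol j x y).trans (le_of_eq (by ring))⟩
  · have := Finset.sum_nonneg fun j (_ : j ∈ Finset.univ) => hc0 j
    positivity
  · have h2 := hpol j x x
    rw [QuadraticMap.polar_self, two_nsmul, ← two_mul, abs_mul, abs_two] at h2
    nlinarith

/-- The first `d` coordinates of a frequency. -/
def horizontal (ξ : Space d n) : Fin d → ℝ := fun x => ξ (Sum.inl x)

theorem mem_uncertaintyBox_iff_polar (P : Fin n → QuadraticForm ℝ (Fin d → ℝ)) (C : ℝ) {k : ℕ}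
    (i : CubeIndex d k) (ξ : Space d n) :
    ξ ∈ uncertaintyBox P C i ↔ (∀ x, |horizontal ξ x - corner i x| ≤ scale k * C) ∧
      ∀ j, |ξ (Sum.inr j) - P j (corner i)
        - QuadraticMap.polar (P j) (corner i) (horizontal ξ - corner i)| ≤ scale k ^ 2 * C := by
  have h0 := scale_pos k
  constructor
  · rintro ⟨u, w, hu, hw, h1, h2⟩
    have h3 : horizontal ξ - corner i = scale k • u := by
      ext x
      simp [horizontal, h1]
    refine ⟨fun x => ?_, fun j => ?_⟩
    · rw [← Pi.sub_apply, h3, Pi.smul_apply, smul_eq_mul, abs_mul, abs_of_pos h0]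
      exact mul_le_mul_of_nonneg_left (hu x) h0.le
    · rw [h3, QuadraticMap.polar_smul_right, h2, smul_eq_mul]
      have : P j (corner i) + scale k * QuadraticMap.polar (P j) (corner i) u + scale k ^ 2 * w j
        - P j (corner i) - scale k * QuadraticMap.polar (P j) (corner i) u = scale k ^ 2 * w j := by
        ring
      rw [this, abs_mul, abs_of_pos (by positivity)]
      exact mul_le_mul_of_nonneg_left (hw j) (by positivity)
  · rintro ⟨h1, h2⟩
    refine ⟨(scale k)⁻¹ • (horizontal ξ - corner i), fun j => (scale k ^ 2)⁻¹ *
      (ξ (Sum.inr j) - P j (corner i)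
        - QuadraticMap.polar (P j) (corner i) (horizontal ξ - corner i)), ?_, ?_, ?_, ?_⟩
    · intro x
      rw [Pi.smul_apply, smul_eq_mul, abs_mul, abs_of_pos (by positivity), Pi.sub_apply,
        inv_mul_le_iff₀ h0]
      exact h1 x
    · intro j
      rw [abs_mul, abs_of_pos (by positivity), inv_mul_le_iff₀ (by positivity)]
      exact h2 j
    · intro x
      rw [Pi.smul_apply, smul_eq_mul, mul_inv_cancel_left₀ h0.ne', Pi.sub_apply]
      simp [horizontal]
    · intro j
      rw [QuadraticMap.polar_smul_right, smul_eq_mul, mul_inv_cancel_left₀ h0.ne',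
        mul_inv_cancel_left₀ (by positivity)]
      ring

/-- For a quadratic form the tangent approximation at `a` has error exactly `P (t - a)`. In this
form the box involves only the height `s - P t` above the graph and the displacement `t - a`, which
is convenient for rescaling and shearing. -/
theorem mem_uncertaintyBox_iff (P : Fin n → QuadraticForm ℝ (Fin d → ℝ)) {C : ℝ} (hC : 0 ≤ C)
    {k : ℕ} (i : CubeIndex d k) (ξ : Space d n) :
    ξ ∈ uncertaintyBox P C i ↔ ‖horizontal ξ - corner i‖ ≤ scale k * C ∧
      ∀ j, |ξ (Sum.inr j) - P j (horizontal ξ) + P j (horizontal ξ - corner i)|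
        ≤ scale k ^ 2 * C := by
  have h0 := scale_pos k
  rw [mem_uncertaintyBox_iff_polar, pi_norm_le_iff_of_nonneg (by positivity)]
  refine and_congr Iff.rfl (forall_congr' fun j => ?_)
  rw [QuadraticMap.polar, add_sub_cancel]
  have : ξ (Sum.inr j) - P j (corner i)
    - (P j (horizontal ξ) - P j (corner i) - P j (horizontal ξ - corner i))
    = ξ (Sum.inr j) - P j (horizontal ξ) + P j (horizontal ξ - corner i) := by ring
  rw [this]

theorem isClosed_uncertaintyBox (P : Fin n → QuadraticForm ℝ (Fin d → ℝ)) (C : ℝ) {k : ℕ}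
    (i : CubeIndex d k) : IsClosed (uncertaintyBox P C i) := by
  have h : uncertaintyBox P C i = (⋂ x, {ξ | |horizontal ξ x - corner i x| ≤ scale k * C}) ∩
      ⋂ j, {ξ | |ξ (Sum.inr j) - P j (corner i)
        - QuadraticMap.polar (P j) (corner i) (horizontal ξ - corner i)| ≤ scale k ^ 2 * C} := by
    ext ξ
    rw [mem_uncertaintyBox_iff_polar]
    simp
  have hh : Continuous (horizontal : Space d n → _) := by unfold horizontal; fun_prop
  rw [h]
  refine (isClosed_iInter fun x => isClosed_le ?_ continuous_const).inter
    (isClosed_iInter fun j => isClosed_le ?_ continuous_const)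
  · unfold horizontal; fun_prop
  · have hp : Continuous fun y => QuadraticMap.polar (P j) (corner i) y :=
      LinearMap.continuous_of_finiteDimensional ((P j).polarBilin (corner i))
    have h1 : Continuous fun ξ : Space d n =>
        QuadraticMap.polar (P j) (corner i) (horizontal ξ - corner i) :=
      hp.comp (f := fun ξ : Space d n => horizontal ξ - corner i) (hh.sub continuous_const)
    fun_prop

/-- The linear part of the affine map `(t, s) ↦ (ℓ (t - v), b (s - P t + P (t - v)))`. -/
def shearLinear {d' : ℕ} (P : Fin n → QuadraticForm ℝ (Fin d → ℝ))
    (ℓ : (Fin d → ℝ) →ₗ[ℝ] (Fin d' → ℝ)) (v : Fin d → ℝ) (b : ℝ) :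
    Space d n →ₗ[ℝ] Space d' n where
  toFun ξ := WithLp.toLp 2 (Sum.elim (ℓ (horizontal ξ))
    fun j => b * (ξ (Sum.inr j) - QuadraticMap.polar (P j) v (horizontal ξ)))
  map_add' ξ ζ := by
    have h : horizontal (ξ + ζ) = horizontal ξ + horizontal ζ := rfl
    ext (x | j)
    · simp [h]
    · simp [h, QuadraticMap.polar_add_right]; ring
  map_smul' a ξ := by
    have h : horizontal (a • ξ) = a • horizontal ξ := rfl
    ext (x | j)
    · simp [h]
    · simp [h, QuadraticMap.polar_smul_right]; ring

/-- The translation part of the affine map `(t, s) ↦ (ℓ (t - v), b (s - P t + P (t - v)))`. -/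
def shearConst {d' : ℕ} (P : Fin n → QuadraticForm ℝ (Fin d → ℝ))
    (ℓ : (Fin d → ℝ) →ₗ[ℝ] (Fin d' → ℝ)) (v : Fin d → ℝ) (b : ℝ) : Space d' n :=
  WithLp.toLp 2 (Sum.elim (-ℓ v) fun j => b * P j v)

theorem horizontal_shear {d' : ℕ} (P : Fin n → QuadraticForm ℝ (Fin d → ℝ))
    (ℓ : (Fin d → ℝ) →ₗ[ℝ] (Fin d' → ℝ)) (v : Fin d → ℝ) (b : ℝ) (ξ : Space d n) :
    horizontal (shearLinear P ℓ v b ξ + shearConst P ℓ v b) = ℓ (horizontal ξ - v) := by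
  ext x
  simp [horizontal, shearLinear, shearConst, sub_eq_add_neg]

/-- The quadratic terms of `P t` and `P (t - v)` cancel, so the right side is affine in `ξ` although
it is written with `P`. -/
theorem shear_inr {d' : ℕ} (P : Fin n → QuadraticForm ℝ (Fin d → ℝ))
    (ℓ : (Fin d → ℝ) →ₗ[ℝ] (Fin d' → ℝ)) (v : Fin d → ℝ) (b : ℝ) (ξ : Space d n) (j : Fin n) :
    (shearLinear P ℓ v b ξ + shearConst P ℓ v b) (Sum.inr j)
      = b * (ξ (Sum.inr j) - P j (horizontal ξ) + P j (horizontal ξ - v)) := by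
  have h1 : QuadraticMap.polar (P j) v (horizontal ξ)
      = 2 * P j v + QuadraticMap.polar (P j) v (horizontal ξ - v) := by
    rw [QuadraticMap.polar_sub_right, QuadraticMap.polar_self, two_nsmul]
    ring
  have h2 : QuadraticMap.polar (P j) v (horizontal ξ - v)
      = P j (horizontal ξ) - P j v - P j (horizontal ξ - v) := by
    rw [QuadraticMap.polar, add_sub_cancel]
  simp [shearLinear, shearConst, h1, h2]
  ring

theorem shearLinear_surjective {d' : ℕ} (P : Fin n → QuadraticForm ℝ (Fin d → ℝ))
    {ℓ : (Fin d → ℝ) →ₗ[ℝ] (Fin d' → ℝ)} (hℓ : Function.Surjective ℓ) (v : Fin d → ℝ) {b : ℝ}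
    (hb : b ≠ 0) : Function.Surjective (shearLinear P ℓ v b) := by
  intro ζ
  obtain ⟨t, ht⟩ := hℓ (horizontal ζ)
  refine ⟨WithLp.toLp 2 (Sum.elim t fun j => b⁻¹ * ζ (Sum.inr j) + QuadraticMap.polar (P j) v t), ?_⟩
  have h1 : horizontal (WithLp.toLp 2 (Sum.elim t fun j =>
      b⁻¹ * ζ (Sum.inr j) + QuadraticMap.polar (P j) v t) : Space d n) = t := by
    ext x; simp [horizontal]
  ext (x | j)
  · simp [shearLinear, h1, ht, horizontal]
  · simp [shearLinear, h1, hb]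

end Forms

/-! ### Stability of Fourier support conditions. -/

section Support

variable {d n : ℕ} {p : ℝ≥0∞} [Fact (1 ≤ p)]

theorem HasFourierSupportIn.mono {f : Lp ℂ p (volume : Measure (Space d n))}
    {U V : Set (Space d n)} (hf : HasFourierSupportIn f U) (h : U ⊆ V) :
    HasFourierSupportIn f V :=
  Subset.trans hf h

theorem HasFourierSupportIn.sum {ι : Type*} {s : Finset ι}
    {f : ι → Lp ℂ p (volume : Measure (Space d n))} {U : Set (Space d n)} (hU : IsClosed U)
    (hf : ∀ i ∈ s, HasFourierSupportIn (f i) U) : HasFourierSupportIn (∑ i ∈ s, f i) U := by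
  have h1 : (𝓕 (Lp.toTemperedDistribution (∑ i ∈ s, f i)) : 𝓢'(Space d n, ℂ)) =
      ∑ i ∈ s, (𝓕 (Lp.toTemperedDistribution (f i)) : 𝓢'(Space d n, ℂ)) := by
    have h2 : Lp.toTemperedDistribution (∑ i ∈ s, f i) =
        ∑ i ∈ s, Lp.toTemperedDistribution (f i) :=
      map_sum (Lp.toTemperedDistributionCLM ℂ (volume : Measure (Space d n)) p) f s
    rw [h2]
    exact map_sum (FourierTransform.fourierCLM ℂ 𝓢'(Space d n, ℂ)) _ _
  unfold HasFourierSupportIn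
  rw [h1]
  exact dsupport_sum_subset s _ hU hf

theorem hasFourierSupportIn_zero {U : Set (Space d n)} (hU : IsClosed U) :
    HasFourierSupportIn (0 : Lp ℂ p (volume : Measure (Space d n))) U := by
  have := HasFourierSupportIn.sum (p := p) (s := (∅ : Finset ℕ)) (f := fun _ => 0) hU (by simp)
  simpa using this

end Support

/-! ### Trivial, localized and nested decoupling inequalities. -/

section Inequalities

variable {d n : ℕ} {p : ℝ≥0∞} [Fact (1 ≤ p)] {P : Fin n → QuadraticForm ℝ (Fin d → ℝ)} {C : ℝ}

theorem DecouplesWith.mono {k : ℕ} {s : Finset (CubeIndex d k)} {A A' : ℝ}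
    (h : DecouplesWith P C p k s A) (hA : A ≤ A') : DecouplesWith P C p k s A' := fun f hf =>
  (h f hf).trans (mul_le_mul_of_nonneg_right hA
    (Real.rpow_nonneg (Finset.sum_nonneg fun i _ => by positivity) _))

/-- It is enough to test a decoupling inequality on the functions that occur in it. -/
theorem DecouplesWith.norm_sum_le {k : ℕ} {s : Finset (CubeIndex d k)} {A : ℝ}
    (h : DecouplesWith P C p k s A) (f : CubeIndex d k → Lp ℂ p (volume : Measure (Space d n)))
    (hf : ∀ i ∈ s, HasFourierSupportIn (f i) (uncertaintyBox P C i)) :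
    ‖∑ i ∈ s, f i‖ ≤ A * (∑ i ∈ s, ‖f i‖ ^ p.toReal) ^ (1 / p.toReal) := by
  classical
  have h1 := h (fun i => if i ∈ s then f i else 0) fun i => by
    by_cases hi : i ∈ s
    · simpa [hi] using hf i hi
    · simpa [hi] using hasFourierSupportIn_zero (isClosed_uncertaintyBox P C i)
  rw [Finset.sum_congr rfl fun i hi => if_pos hi] at h1
  rwa [Finset.sum_congr rfl fun i (hi : i ∈ s) => show _ = ‖f i‖ ^ p.toReal by rw [if_pos hi]] at h1

/-- Each summand is at most the `ℓʳ` norm of all of them. This crude bound is used only for finitely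
many scales and for fibres of bounded cardinality. -/
theorem norm_sum_le_card_mul {ι V : Type*} [SeminormedAddCommGroup V] (s : Finset ι) (f : ι → V)
    {r : ℝ} (hr : 0 < r) :
    ‖∑ i ∈ s, f i‖ ≤ s.card * (∑ i ∈ s, ‖f i‖ ^ r) ^ (1 / r) := by
  refine (norm_sum_le _ _).trans ?_
  rw [← nsmul_eq_mul]
  refine Finset.sum_le_card_nsmul _ _ _ fun i hi => ?_
  have h1 : ‖f i‖ ^ r ≤ ∑ i ∈ s, ‖f i‖ ^ r :=
    Finset.single_le_sum (f := fun i => ‖f i‖ ^ r) (fun j _ => by positivity) hi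
  have h2 := Real.rpow_le_rpow (by positivity) h1 (by positivity : 0 ≤ 1 / r)
  rwa [← Real.rpow_mul (norm_nonneg _), mul_one_div_cancel hr.ne', Real.rpow_one] at h2

theorem decouplesWith_card (hp : 0 < p.toReal) {k : ℕ} (s : Finset (CubeIndex d k)) :
    DecouplesWith P C p k s s.card := fun f _ => norm_sum_le_card_mul s f hp

/-- Two nested decoupling inequalities compose. -/
theorem norm_sum_le_of_fiberwise {ι κ V : Type*} [DecidableEq κ] [SeminormedAddCommGroup V]
    (s : Finset ι) (π : ι → κ) (f : ι → V) {r A B : ℝ} (hr : 0 < r) (hA : 0 ≤ A) (hB : 0 ≤ B)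
    (hcoarse : ‖∑ i ∈ s, f i‖ ≤
      A * (∑ τ ∈ s.image π, ‖∑ i ∈ s with π i = τ, f i‖ ^ r) ^ (1 / r))
    (hfine : ∀ τ ∈ s.image π, ‖∑ i ∈ s with π i = τ, f i‖ ≤
      B * (∑ i ∈ s with π i = τ, ‖f i‖ ^ r) ^ (1 / r)) :
    ‖∑ i ∈ s, f i‖ ≤ A * B * (∑ i ∈ s, ‖f i‖ ^ r) ^ (1 / r) := by
  refine hcoarse.trans ?_
  rw [mul_assoc]
  refine mul_le_mul_of_nonneg_left ?_ hA
  have hS : ∀ t : Finset ι, 0 ≤ ∑ i ∈ t, ‖f i‖ ^ r := fun t =>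
    Finset.sum_nonneg fun i _ => by positivity
  have h1 : ∑ τ ∈ s.image π, ‖∑ i ∈ s with π i = τ, f i‖ ^ r ≤ B ^ r * ∑ i ∈ s, ‖f i‖ ^ r := by
    rw [← Finset.sum_fiberwise_of_maps_to (g := π) (t := s.image π)
      (fun i hi => Finset.mem_image_of_mem π hi) fun i => ‖f i‖ ^ r, Finset.mul_sum]
    exact Finset.sum_le_sum fun τ hτ =>
      (rpow_le_of_le_mul_rpow hr (norm_nonneg _) (hS _) hB).1 (hfine τ hτ)
  have h2 := (rpow_le_of_le_mul_rpow (a := (∑ τ ∈ s.image π, ‖∑ i ∈ s with π i = τ, f i‖ ^ r) ^ (1 / r))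
    hr (Real.rpow_nonneg (Finset.sum_nonneg fun i _ => by positivity) _) (hS s) hB).2
  refine h2 ?_
  rwa [← Real.rpow_mul (Finset.sum_nonneg fun i _ => by positivity), one_div_mul_cancel hr.ne',
    Real.rpow_one]

end Inequalities

/-! ### Parabolic rescaling and nesting of boxes. -/

section Rescaling

variable {d n : ℕ} {p : ℝ≥0∞} [Fact (1 ≤ p)] {P : Fin n → QuadraticForm ℝ (Fin d → ℝ)} {C : ℝ}

theorem norm_horizontal_sub {k : ℕ} (i : CubeIndex d k) (hC : 0 ≤ C) {ξ : Space d n}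
    (hξ : ξ ∈ uncertaintyBox P C i) : ‖horizontal ξ - corner i‖ ≤ scale k * C :=
  ((mem_uncertaintyBox_iff P hC i ξ).1 hξ).1

/-- Decoupling inside a dyadic cube `τ` is decoupling of the unit cube at the relative scale. -/
theorem DecouplesWith.norm_sum_le_of_parent_eq (hp1 : 1 < p) (hp : p ≠ ⊤) (hC : 0 ≤ C) {r l : ℕ}
    (τ : CubeIndex d r) (s : Finset (CubeIndex d (r + l))) (hs : ∀ i ∈ s, parent i = τ) {A : ℝ}
    (hA : 0 ≤ A) (hdec : DecouplesWith P C p l (s.image relIndex) A)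
    (f : CubeIndex d (r + l) → Lp ℂ p (volume : Measure (Space d n)))
    (hf : ∀ i ∈ s, HasFourierSupportIn (f i) (uncertaintyBox P C i)) :
    ‖∑ i ∈ s, f i‖ ≤ A * (∑ i ∈ s, ‖f i‖ ^ p.toReal) ^ (1 / p.toReal) := by
  have h0 := scale_pos r
  have hl := scale_pos l
  have hchild : ∀ i ∈ s, childIndex τ (relIndex i) = i := fun i hi => by
    rw [← hs i hi, childIndex_parent_relIndex]
  have hinj : Set.InjOn (relIndex : CubeIndex d (r + l) → CubeIndex d l) s := fun i hi j hj h => by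
    rw [← hchild i hi, ← hchild j hj, h]
  -- The rescaling dilates by `(scale r)⁻¹` horizontally and by `(scale r ^ 2)⁻¹` vertically,
  -- matching the homogeneity of `P`.
  let ℓ : (Fin d → ℝ) →ₗ[ℝ] (Fin d → ℝ) := (scale r)⁻¹ • LinearMap.id
  have hℓ : ∀ t, ℓ t = (scale r)⁻¹ • t := fun t => rfl
  have hsurj : Function.Surjective ℓ := fun t => ⟨scale r • t, by
    rw [hℓ, smul_smul, inv_mul_cancel₀ h0.ne', one_smul]⟩
  refine decoupling_transfer (shearLinear P ℓ (corner τ) (scale r ^ 2)⁻¹)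
    (shearLinear_surjective P hsurj _ (by positivity)) (shearConst P ℓ (corner τ) (scale r ^ 2)⁻¹)
    hp1 hp s (fun i => uncertaintyBox P C (relIndex i))
    (fun i _ => isClosed_uncertaintyBox P C _) hA ?_ f ?_
  · intro g hg
    have h1 := hdec.norm_sum_le (fun e => g (childIndex τ e)) fun e he => by
      obtain ⟨i, hi, rfl⟩ := Finset.mem_image.1 he
      rw [hchild i hi]
      exact hg i hi
    rw [Finset.sum_image hinj, Finset.sum_image hinj,
      Finset.sum_congr rfl fun i hi => by rw [hchild i hi]] at h1
    rwa [Finset.sum_congr rfl fun i (hi : i ∈ s) =>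
      show ‖g (childIndex τ (relIndex i))‖ ^ p.toReal = ‖g i‖ ^ p.toReal by rw [hchild i hi]] at h1
  · intro i hi ξ hξ
    have hξ' := (mem_uncertaintyBox_iff P hC i ξ).1 (hf i hi hξ)
    rw [mem_uncertaintyBox_iff P hC, horizontal_shear]
    have hcor : ℓ (horizontal ξ - corner τ) - corner (relIndex i)
        = (scale r)⁻¹ • (horizontal ξ - corner i) := by
      rw [corner_eq_parent_add i, hs i hi, hℓ, ← sub_sub, smul_sub _ _ (scale r • _), smul_smul,
        inv_mul_cancel₀ h0.ne', one_smul]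
    refine ⟨?_, fun j => ?_⟩
    · rw [hcor, norm_smul, Real.norm_of_nonneg (by positivity), inv_mul_le_iff₀ h0, ← mul_assoc,
        ← scale_add]
      exact hξ'.1
    · have h1 := hξ'.2 j
      rw [shear_inr, hcor, hℓ, QuadraticMap.map_smul, QuadraticMap.map_smul, smul_eq_mul,
        smul_eq_mul]
      have h2 : (scale r ^ 2)⁻¹ * (ξ (Sum.inr j) - P j (horizontal ξ) + P j (horizontal ξ - corner τ))
          - (scale r)⁻¹ * (scale r)⁻¹ * P j (horizontal ξ - corner τ)
          + (scale r)⁻¹ * (scale r)⁻¹ * P j (horizontal ξ - corner i)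
          = (scale r ^ 2)⁻¹ * (ξ (Sum.inr j) - P j (horizontal ξ)
            + P j (horizontal ξ - corner i)) := by
        field_simp
        ring
      rw [h2, abs_mul, abs_of_pos (by positivity), inv_mul_le_iff₀ (by positivity), ← mul_assoc,
        ← mul_pow, ← scale_add]
      exact h1

theorem norm_horizontal_sub_corner_parent_le {r l : ℕ} {i : CubeIndex d (r + l)} (hC : 0 ≤ C)
    (hlC : scale l * C ≤ 1) {ξ : Space d n} (hξ : ξ ∈ uncertaintyBox P C i) :
    ‖horizontal ξ - corner (parent i)‖ ≤ 2 * scale r := by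
  have h0 := scale_pos r
  have h1 : horizontal ξ - corner (parent i)
      = (horizontal ξ - corner i) + scale r • corner (relIndex i) := by
    rw [corner_eq_parent_add i]; abel
  rw [h1]
  refine (norm_add_le _ _).trans ?_
  have h2 := norm_horizontal_sub i hC hξ
  have h3 := norm_corner_le_one (relIndex i)
  rw [norm_smul, Real.norm_of_nonneg h0.le]
  rw [scale_add, mul_assoc] at h2
  nlinarith

/-- The box is thin about a tangent plane, which leaves the graph of `P` only quadratically; so the
whole box is within `O(δ²)` of the graph. -/
theorem abs_sub_form_le {c : ℝ} (hc : ∀ j x, |P j x| ≤ c * ‖x‖ ^ 2) (hc0 : 0 ≤ c) {k : ℕ}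
    {i : CubeIndex d k} (hC : 0 ≤ C) {ξ : Space d n} (hξ : ξ ∈ uncertaintyBox P C i) (j : Fin n) :
    |ξ (Sum.inr j) - P j (horizontal ξ)| ≤ scale k ^ 2 * (C + c * C ^ 2) := by
  obtain ⟨h1, h2⟩ := (mem_uncertaintyBox_iff P hC i ξ).1 hξ
  have h3 := hc j (horizontal ξ - corner i)
  have h4 : c * ‖horizontal ξ - corner i‖ ^ 2 ≤ c * (scale k * C) ^ 2 := by gcongr
  have h5 := h2 j
  rw [abs_le] at *
  constructor <;> nlinarith

/-- The uncertainty box of a small dyadic cube is contained in that of an ancestor. -/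
theorem uncertaintyBox_subset_parent {c : ℝ} (hc : ∀ j x, |P j x| ≤ c * ‖x‖ ^ 2) (hc0 : 0 ≤ c)
    (hC2 : 2 ≤ C) (hCc : 4 * c + 1 ≤ C) {r l : ℕ} (hl : scale l * (C + c * C ^ 2) ≤ 1)
    (i : CubeIndex d (r + l)) : uncertaintyBox P C i ⊆ uncertaintyBox P C (parent i) := by
  intro ξ hξ
  have hC : 0 ≤ C := by linarith
  have h0 := scale_pos r
  have hl0 := scale_pos l
  have hlC : scale l * C ≤ 1 := by nlinarith [mul_nonneg hl0.le (mul_nonneg hc0 (sq_nonneg C))]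
  have h1 := norm_horizontal_sub_corner_parent_le hC hlC hξ
  rw [mem_uncertaintyBox_iff P hC]
  refine ⟨h1.trans (by nlinarith), fun j => ?_⟩
  have h2 := abs_sub_form_le hc hc0 hC hξ j
  have h3 := hc j (horizontal ξ - corner (parent i))
  have h4 : c * ‖horizontal ξ - corner (parent i)‖ ^ 2 ≤ c * (2 * scale r) ^ 2 := by gcongr
  have h5 : scale l ^ 2 * (C + c * C ^ 2) ≤ 1 := by
    rw [sq, mul_assoc]
    exact mul_le_one₀ (scale_le_one l) (by positivity) hl
  rw [scale_add, mul_pow, mul_assoc] at h2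
  have h6 : scale r ^ 2 * (scale l ^ 2 * (C + c * C ^ 2)) ≤ scale r ^ 2 * 1 := by gcongr
  have h7 : scale r ^ 2 * (4 * c + 1) ≤ scale r ^ 2 * C := by gcongr
  refine (abs_add_le _ _).trans ?_
  nlinarith

end Rescaling

/-! ### Families of cubes near a hyperplane. -/

section Hyperplanes

variable {m n : ℕ}

/-- Forgetting the coordinate with index `j`. -/
def dropCoord (j : Fin (m + 1)) : (Fin (m + 1) → ℝ) →ₗ[ℝ] (Fin m → ℝ) :=
  LinearMap.funLeft ℝ ℝ j.succAbove

theorem dropCoord_apply (j : Fin (m + 1)) (t : Fin (m + 1) → ℝ) (x : Fin m) :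
    dropCoord j t x = t (j.succAbove x) := rfl

theorem dropCoord_surjective (j : Fin (m + 1)) : Function.Surjective (dropCoord j) :=
  LinearMap.funLeft_surjective_of_injective ℝ ℝ _ Fin.succAbove_right_injective

theorem norm_dropCoord_le (j : Fin (m + 1)) (t : Fin (m + 1) → ℝ) : ‖dropCoord j t‖ ≤ ‖t‖ :=
  (pi_norm_le_iff_of_nonneg (norm_nonneg _)).2 fun _ => norm_le_pi_norm t _

theorem graphMap_apply_same (j : Fin (m + 1)) (φ : (Fin m → ℝ) →ₗ[ℝ] ℝ) (t : Fin m → ℝ) :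
    graphMap j φ t j = φ t := by
  simp [graphMap]

theorem graphMap_apply_succAbove (j : Fin (m + 1)) (φ : (Fin m → ℝ) →ₗ[ℝ] ℝ) (t : Fin m → ℝ)
    (x : Fin m) : graphMap j φ t (j.succAbove x) = t x := by
  simp [graphMap]

theorem eq_graphMap_add_single (j : Fin (m + 1)) (φ : (Fin m → ℝ) →ₗ[ℝ] ℝ)
    (t : Fin (m + 1) → ℝ) :
    t = graphMap j φ (dropCoord j t) + (t j - φ (dropCoord j t)) • Pi.single j (1 : ℝ) := by
  ext x
  rcases Fin.eq_self_or_eq_succAbove j x with rfl | ⟨y, rfl⟩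
  · simp [graphMap_apply_same]
  · simp [graphMap_apply_succAbove, dropCoord_apply]

theorem dropCoord_single (j : Fin (m + 1)) (a : ℝ) : dropCoord j (Pi.single j a) = 0 := by
  ext x
  simp [dropCoord_apply]

theorem abs_linearForm_le {φ : (Fin m → ℝ) →ₗ[ℝ] ℝ} (hφ : ∀ x, |φ (Pi.single x 1)| ≤ 1)
    (t : Fin m → ℝ) : |φ t| ≤ m * ‖t‖ := by
  have h1 : φ t = ∑ x, t x * φ (Pi.single x 1) := by
    rw [LinearMap.pi_apply_eq_sum_univ φ t]
    refine Finset.sum_congr rfl fun x _ => ?_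
    rw [smul_eq_mul]
    congr 2
    ext y
    simp [Pi.single_apply, eq_comm]
  rw [h1]
  refine (Finset.abs_sum_le_sum_abs _ _).trans ?_
  refine (Finset.sum_le_card_nsmul _ _ ‖t‖ fun x _ => ?_).trans_eq (by simp)
  rw [abs_mul]
  have h2 : |t x| ≤ ‖t‖ := norm_le_pi_norm t x
  nlinarith [hφ x, abs_nonneg (t x), norm_nonneg t]

theorem norm_graphMap_le (j : Fin (m + 1)) {φ : (Fin m → ℝ) →ₗ[ℝ] ℝ}
    (hφ : ∀ x, |φ (Pi.single x 1)| ≤ 1) (t : Fin m → ℝ) :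
    ‖graphMap j φ t‖ ≤ (m + 1) * ‖t‖ := by
  have h0 := norm_nonneg t
  have hm : (0 : ℝ) ≤ m := by positivity
  rw [pi_norm_le_iff_of_nonneg (by positivity)]
  intro x
  rcases Fin.eq_self_or_eq_succAbove j x with rfl | ⟨y, rfl⟩
  · rw [graphMap_apply_same]
    refine (abs_linearForm_le hφ t).trans ?_
    nlinarith
  · rw [graphMap_apply_succAbove]
    refine (norm_le_pi_norm t y).trans ?_
    nlinarith

/-- The height of a point above the graph `t_j = φ(t')`. -/
def height (j : Fin (m + 1)) (φ : (Fin m → ℝ) →ₗ[ℝ] ℝ) : (Fin (m + 1) → ℝ) →ₗ[ℝ] ℝ :=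
  LinearMap.proj j - φ ∘ₗ dropCoord j

theorem height_apply (j : Fin (m + 1)) (φ : (Fin m → ℝ) →ₗ[ℝ] ℝ) (t : Fin (m + 1) → ℝ) :
    height j φ t = t j - φ (dropCoord j t) := rfl

theorem abs_height_le (j : Fin (m + 1)) {φ : (Fin m → ℝ) →ₗ[ℝ] ℝ}
    (hφ : ∀ x, |φ (Pi.single x 1)| ≤ 1) (t : Fin (m + 1) → ℝ) :
    |height j φ t| ≤ (m + 1) * ‖t‖ := by
  rw [height_apply]
  have h1 : |t j| ≤ ‖t‖ := norm_le_pi_norm t j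
  have h2 := abs_linearForm_le hφ (dropCoord j t)
  have h3 := norm_dropCoord_le j t
  have hm : (0 : ℝ) ≤ m := by positivity
  have h4 := mul_le_mul_of_nonneg_left h3 hm
  have h5 := abs_sub (t j) (φ (dropCoord j t))
  linarith

/-- The lower corners of the dyadic cubes in `s` are within `A 2⁻ᵏ` of a fixed translate of the
hyperplane `t_j = φ(t')`. -/
def IsPlanar (A : ℝ) (j : Fin (m + 1)) (φ : (Fin m → ℝ) →ₗ[ℝ] ℝ) {k : ℕ}
    (s : Finset (CubeIndex (m + 1) k)) : Prop :=
  ∃ c : ℝ, ∀ i ∈ s, |height j φ (corner i) - c| ≤ A * scale k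

/-- Rescaling `τ` to the unit cube preserves the direction of a hyperplane and scales heights like
side lengths. Hence `A`, `j` and `φ` survive, only the offset `c` changes, and the induction can
repeat without loss. -/
theorem IsPlanar.image_relIndex {A : ℝ} {j : Fin (m + 1)} {φ : (Fin m → ℝ) →ₗ[ℝ] ℝ} {r l : ℕ}
    {s : Finset (CubeIndex (m + 1) (r + l))} (h : IsPlanar A j φ s) {τ : CubeIndex (m + 1) r}
    {s' : Finset (CubeIndex (m + 1) (r + l))} (hs : s' ⊆ s) (hτ : ∀ i ∈ s', parent i = τ) :
    IsPlanar A j φ (s'.image relIndex) := by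
  obtain ⟨c, hc⟩ := h
  have h0 := scale_pos r
  refine ⟨(scale r)⁻¹ * (c - height j φ (corner τ)), fun e he => ?_⟩
  obtain ⟨i, hi, rfl⟩ := Finset.mem_image.1 he
  have h1 := hc i (hs hi)
  rw [corner_eq_parent_add i, hτ i hi, map_add, map_smul, smul_eq_mul, scale_add] at h1
  have h2 : height j φ (corner (relIndex i)) - (scale r)⁻¹ * (c - height j φ (corner τ))
      = (scale r)⁻¹ * (height j φ (corner τ) + scale r * height j φ (corner (relIndex i)) - c) := by
    field_simp
    ring
  rw [h2, abs_mul, abs_of_pos (by positivity), inv_mul_le_iff₀ h0]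
  linarith

/-- Forgetting a coordinate of a dyadic cube. -/
def dropIndex (j : Fin (m + 1)) {k : ℕ} (τ : CubeIndex (m + 1) k) : CubeIndex m k := fun x =>
  τ (j.succAbove x)

theorem corner_dropIndex (j : Fin (m + 1)) {k : ℕ} (τ : CubeIndex (m + 1) k) :
    corner (dropIndex j τ) = dropCoord j (corner τ) := rfl

theorem card_le_of_abs_sub_le (T : Finset ℕ) {y R : ℝ} (hT : ∀ a ∈ T, |(a : ℝ) - y| ≤ R)
    (hR : 0 ≤ R) : (T.card : ℝ) ≤ 2 * R + 1 := by
  have h1 : T.image (fun a : ℕ => (a : ℤ)) ⊆ Finset.Icc ⌈y - R⌉ ⌊y + R⌋ := by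
    intro b hb
    obtain ⟨a, ha, rfl⟩ := Finset.mem_image.1 hb
    have := abs_le.1 (hT a ha)
    rw [Finset.mem_Icc, Int.ceil_le, Int.le_floor, Int.cast_natCast]
    constructor <;> linarith
  have h2 := Finset.card_le_card h1
  rw [Finset.card_image_of_injective _ Nat.cast_injective, Int.card_Icc] at h2
  have h3 : ((⌊y + R⌋ + 1 - ⌈y - R⌉).toNat : ℝ) ≤ 2 * R + 1 := by
    have h4 : ((⌊y + R⌋ + 1 - ⌈y - R⌉ : ℤ) : ℝ) ≤ 2 * R + 1 := by
      push_cast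
      have := Int.floor_le (y + R)
      have := Int.le_ceil (y - R)
      linarith
    rcases le_total 0 (⌊y + R⌋ + 1 - ⌈y - R⌉) with h | h
    · rw [← Int.toNat_of_nonneg h] at h4
      exact_mod_cast h4
    · rw [Int.toNat_of_nonpos h]
      push_cast
      linarith
  exact le_trans (by exact_mod_cast h2) h3

/-- Over a given `m`-dimensional dyadic cube there are boundedly many ancestors of the cubes in a
planar family. -/
theorem IsPlanar.card_fiber_le {A : ℝ} (hA : 0 ≤ A) {j : Fin (m + 1)} {φ : (Fin m → ℝ) →ₗ[ℝ] ℝ}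
    (hφ : ∀ x, |φ (Pi.single x 1)| ≤ 1) {r l : ℕ}
    {s : Finset (CubeIndex (m + 1) (r + l))} (h : IsPlanar A j φ s) (e : CubeIndex m r) :
    (((s.image parent).filter fun τ => dropIndex j τ = e).card : ℝ) ≤ 2 * (A + m + 1) + 1 := by
  obtain ⟨c, hc⟩ := h
  have h0 := scale_pos r
  set T := (s.image parent).filter fun τ => dropIndex j τ = e with hT
  have hinj : Set.InjOn (fun τ : CubeIndex (m + 1) r => (τ j : ℕ)) T := by
    intro τ hτ τ' hτ' hj
    have h1 := (Finset.mem_filter.1 hτ).2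
    have h2 := (Finset.mem_filter.1 hτ').2
    ext x
    rcases Fin.eq_self_or_eq_succAbove j x with rfl | ⟨y, rfl⟩
    · exact hj
    · have h3 := congrFun (h1.trans h2.symm) y
      exact congrArg Fin.val h3
  rw [← Finset.card_image_of_injOn hinj]
  -- The remaining coordinate is nearly determined by the height `c`. In units of `scale r`,
  -- planarity leaves an error `A`, and passing from a cube to its ancestor an error `m + 1`.
  refine card_le_of_abs_sub_le _ (y := (scale r)⁻¹ * (c + φ (corner e))) ?_ (by positivity)
  intro a ha
  obtain ⟨τ, hτ, rfl⟩ := Finset.mem_image.1 ha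
  obtain ⟨hτ1, hτ2⟩ := Finset.mem_filter.1 hτ
  obtain ⟨i, hi, rfl⟩ := Finset.mem_image.1 hτ1
  have h1 := hc i hi
  rw [corner_eq_parent_add i, map_add, map_smul, smul_eq_mul] at h1
  have h2 := abs_height_le j hφ (corner (relIndex i))
  have h3 := norm_corner_le_one (relIndex i)
  have hm : (0 : ℝ) < m + 1 := by positivity
  have h4 : |height j φ (corner (relIndex i))| ≤ m + 1 := by nlinarith
  have h5 : |scale r * height j φ (corner (relIndex i))| ≤ scale r * (m + 1) := by
    rw [abs_mul, abs_of_pos h0]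
    gcongr
  have h6 : height j φ (corner (parent i)) = scale r * ((parent i j : ℕ) : ℝ) - φ (corner e) := by
    rw [height_apply, ← corner_dropIndex, hτ2]
    rfl
  have h7 : A * scale (r + l) ≤ A * scale r := by
    gcongr
    exact scale_anti (by omega)
  have h8 : ((parent i j : ℕ) : ℝ) - (scale r)⁻¹ * (c + φ (corner e))
      = (scale r)⁻¹ * (height j φ (corner (parent i)) - c) := by
    rw [h6]
    field_simp
    ring
  rw [h8, abs_mul, abs_of_pos (by positivity), inv_mul_le_iff₀ h0]
  rw [abs_le] at *
  constructor <;> nlinarith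

/-- A shear maps the uncertainty boxes of the small cubes near the hyperplane `t_j = φ(t') + c` into
the uncertainty boxes of the restricted forms at a coarser scale. -/
theorem shear_mem_uncertaintyBox {P : Fin n → QuadraticForm ℝ (Fin (m + 1) → ℝ)} {C c₀ : ℝ}
    (hc : ∀ i x, |P i x| ≤ c₀ * ‖x‖ ^ 2)
    (hpol : ∀ i x y, |QuadraticMap.polar (P i) x y| ≤ 2 * c₀ * ‖x‖ * ‖y‖) (hc0 : 0 ≤ c₀)
    (hC2 : 2 ≤ C) (hCc : 4 * c₀ * (m + 1) ^ 2 + 1 ≤ C) {A H : ℝ} (hA : 0 ≤ A)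
    (hH : H = (m + 1) * C + A)
    {j : Fin (m + 1)} {φ : (Fin m → ℝ) →ₗ[ℝ] ℝ} (hφ : ∀ x, |φ (Pi.single x 1)| ≤ 1) {r l : ℕ}
    (hl : scale l * (6 * c₀ * (m + 1) * H + c₀ * H ^ 2 + C + c₀ * C ^ 2) ≤ scale r)
    {i : CubeIndex (m + 1) (r + l)} {c : ℝ}
    (hi : |height j φ (corner i) - c| ≤ A * scale (r + l)) {ξ : Space (m + 1) n}
    (hξ : ξ ∈ uncertaintyBox P C i) :
    shearLinear P (dropCoord j) (Pi.single j c) 1 ξ + shearConst P (dropCoord j) (Pi.single j c) 1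
      ∈ uncertaintyBox (fun x => (P x).comp (graphMap j φ)) C (dropIndex j (parent i)) := by
  have hC : 0 ≤ C := by linarith
  have h0 := scale_pos r
  have hl0 := scale_pos l
  have hr1 := scale_le_one r
  have hH0 : 0 ≤ H := by rw [hH]; positivity
  have hm : (0 : ℝ) ≤ m := by positivity
  have hlC : scale l * C ≤ 1 := by
    have : 0 ≤ scale l * (6 * c₀ * (m + 1) * H + c₀ * H ^ 2 + c₀ * C ^ 2) := by positivity
    nlinarith
  have hpar := norm_horizontal_sub_corner_parent_le hC hlC hξ
  set t := horizontal ξ with ht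
  set b := corner (parent i) with hb
  rw [mem_uncertaintyBox_iff _ hC, horizontal_shear, map_sub, dropCoord_single, sub_zero,
    corner_dropIndex, ← map_sub]
  have hdrop : ‖dropCoord j (t - b)‖ ≤ 2 * scale r := (norm_dropCoord_le j _).trans hpar
  refine ⟨hdrop.trans (by nlinarith), fun y => ?_⟩
  rw [shear_inr, one_mul, ← ht]
  simp only [QuadraticMap.comp_apply]
  set h : ℝ := height j φ t - c with hh
  -- After the offset `c` is removed, `t` is a point of the hyperplane plus a small multiple `h` of
  -- the `j`-th unit vector, so `P` there is the restricted form up to terms in `h` and `h ^ 2`.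
  have hdec : t - Pi.single j c = graphMap j φ (dropCoord j t) + h • Pi.single j (1 : ℝ) := by
    conv_lhs => rw [eq_graphMap_add_single j φ t]
    rw [hh, height_apply, sub_smul (t j - φ (dropCoord j t)), ← Pi.single_smul, ← Pi.single_smul]
    simp only [smul_eq_mul, mul_one, add_sub_assoc]
  -- In `H`, the term `(m + 1) * C` comes from the distance of `t` to the corner of its cube, and
  -- `A` from planarity.
  have hhle : |h| ≤ H * scale (r + l) := by
    have h1 := abs_height_le j hφ (t - corner i)
    have h2 := norm_horizontal_sub i hC hξ
    have h3 : h = height j φ (t - corner i) + (height j φ (corner i) - c) := by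
      rw [map_sub, hh]; ring
    rw [h3, hH]
    refine (abs_add_le _ _).trans ?_
    have h4 : ((m : ℝ) + 1) * ‖t - corner i‖ ≤ (m + 1) * (scale (r + l) * C) := by gcongr
    nlinarith
  have hP : P y (t - Pi.single j c) = P y (graphMap j φ (dropCoord j t))
      + h * QuadraticMap.polar (P y) (graphMap j φ (dropCoord j t)) (Pi.single j 1)
      + h ^ 2 * P y (Pi.single j 1) := by
    rw [hdec, QuadraticMap.map_add (P y), QuadraticMap.map_smul, QuadraticMap.polar_smul_right]
    simp only [smul_eq_mul]
    ring
  have hsing : ‖(Pi.single j 1 : Fin (m + 1) → ℝ)‖ ≤ 1 := by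
    rw [Pi.norm_single]; simp
  have htn : ‖t‖ ≤ 3 := by
    have h1 : t = (t - b) + b := by abel
    rw [h1]
    refine (norm_add_le _ _).trans ?_
    have := norm_corner_le_one (parent i)
    nlinarith
  have hgn : ‖graphMap j φ (dropCoord j t)‖ ≤ 3 * (m + 1) := by
    refine (norm_graphMap_le j hφ _).trans ?_
    have := (norm_dropCoord_le j t).trans htn
    nlinarith
  have e1 : |h * QuadraticMap.polar (P y) (graphMap j φ (dropCoord j t)) (Pi.single j 1)|
      ≤ scale (r + l) * (6 * c₀ * (m + 1) * H) := by
    rw [abs_mul]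
    have h1 := hpol y (graphMap j φ (dropCoord j t)) (Pi.single j 1)
    have h2 : 2 * c₀ * ‖graphMap j φ (dropCoord j t)‖ * ‖(Pi.single j 1 : Fin (m + 1) → ℝ)‖
        ≤ 2 * c₀ * (3 * (m + 1)) * 1 := by gcongr
    calc _ ≤ (H * scale (r + l)) * (2 * c₀ * (3 * (m + 1)) * 1) :=
          mul_le_mul hhle (h1.trans h2) (abs_nonneg _) (by have := scale_pos (r + l); positivity)
      _ = _ := by ring
  have hs1 : scale (r + l) ^ 2 ≤ scale (r + l) := by
    have := scale_le_one (r + l)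
    have := scale_pos (r + l)
    nlinarith
  have e2 : |h ^ 2 * P y (Pi.single j 1)| ≤ scale (r + l) * (c₀ * H ^ 2) := by
    rw [abs_mul, abs_pow]
    have h1 := hc y (Pi.single j 1)
    have h2 : c₀ * ‖(Pi.single j 1 : Fin (m + 1) → ℝ)‖ ^ 2 ≤ c₀ * 1 ^ 2 := by gcongr
    calc _ ≤ (H * scale (r + l)) ^ 2 * (c₀ * 1 ^ 2) :=
          mul_le_mul (by gcongr) (h1.trans h2) (abs_nonneg _) (by positivity)
      _ = scale (r + l) ^ 2 * (c₀ * H ^ 2) := by ring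
      _ ≤ _ := by gcongr
  have e3 : |ξ (Sum.inr y) - P y t| ≤ scale (r + l) * (C + c₀ * C ^ 2) := by
    refine (abs_sub_form_le hc hc0 hC hξ y).trans ?_
    gcongr
  have e4 : |P y (graphMap j φ (dropCoord j (t - b)))| ≤ scale r ^ 2 * (4 * c₀ * (m + 1) ^ 2) := by
    refine (hc y _).trans ?_
    have h1 : ‖graphMap j φ (dropCoord j (t - b))‖ ≤ (m + 1) * (2 * scale r) :=
      (norm_graphMap_le j hφ _).trans (by gcongr)
    calc _ ≤ c₀ * ((m + 1) * (2 * scale r)) ^ 2 := by gcongr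
      _ = _ := by ring
  -- The cross term is only linear in `h`, so the errors are of size `scale (r + l)`; `hl` makes
  -- them fit into the vertical tolerance `scale r ^ 2`.
  have hfin : scale (r + l) * (6 * c₀ * (m + 1) * H + c₀ * H ^ 2 + C + c₀ * C ^ 2)
      ≤ scale r ^ 2 := by
    have := mul_le_mul_of_nonneg_left hl h0.le
    rw [scale_add]
    linarith
  have hCr : scale r ^ 2 * (4 * c₀ * (m + 1) ^ 2 + 1) ≤ scale r ^ 2 * C := by gcongr
  rw [hP]
  have hsplit : ξ (Sum.inr y) - P y t + (P y (graphMap j φ (dropCoord j t))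
      + h * QuadraticMap.polar (P y) (graphMap j φ (dropCoord j t)) (Pi.single j 1)
      + h ^ 2 * P y (Pi.single j 1)) - P y (graphMap j φ (dropCoord j t))
      + P y (graphMap j φ (dropCoord j (t - b)))
      = (ξ (Sum.inr y) - P y t)
      + h * QuadraticMap.polar (P y) (graphMap j φ (dropCoord j t)) (Pi.single j 1)
      + h ^ 2 * P y (Pi.single j 1) + P y (graphMap j φ (dropCoord j (t - b))) := by ring
  rw [hsplit]
  refine (abs_add_le _ _).trans ?_
  refine (add_le_add_left ((abs_add_le _ _).trans (add_le_add_left (abs_add_le _ _) _)) _).trans ?_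
  linarith

end Hyperplanes

/-! ### Induction on scale for planar families. -/

section Planar

variable {m n : ℕ} {p : ℝ≥0∞} [Fact (1 ≤ p)]

theorem DecouplesWith.subset {d : ℕ} {P : Fin n → QuadraticForm ℝ (Fin d → ℝ)} {C : ℝ}
    (hp0 : 0 < p.toReal) {k : ℕ} {s t : Finset (CubeIndex d k)} {A : ℝ}
    (h : DecouplesWith P C p k t A) (hst : s ⊆ t) : DecouplesWith P C p k s A := by
  classical
  intro f hf
  have h1 := h (fun i => if i ∈ s then f i else 0) fun i => by
    by_cases hi : i ∈ s
    · simpa [hi] using hf i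
    · simpa [hi] using hasFourierSupportIn_zero (isClosed_uncertaintyBox P C i)
  have h2 : ∑ i ∈ t, (if i ∈ s then f i else 0) = ∑ i ∈ s, f i := by
    rw [Finset.sum_ite_mem, Finset.inter_eq_right.2 hst]
  have h3 : ∑ i ∈ t, ‖if i ∈ s then f i else 0‖ ^ p.toReal = ∑ i ∈ s, ‖f i‖ ^ p.toReal := by
    rw [← Finset.sum_subset hst (f := fun i => ‖if i ∈ s then f i else 0‖ ^ p.toReal)]
    · exact Finset.sum_congr rfl fun i hi => by rw [if_pos hi]
    · intro i _ hi
      rw [if_neg hi, norm_zero, Real.zero_rpow hp0.ne']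
  rwa [h2, h3] at h1

/-- Functions on small cubes near a hyperplane decouple into coarser cubes as the restriction of
the forms to the hyperplane does. -/
theorem IsPlanar.norm_sum_le (hp1 : 1 < p) (hp : p ≠ ⊤)
    {P : Fin n → QuadraticForm ℝ (Fin (m + 1) → ℝ)} {C c₀ : ℝ}
    (hc : ∀ i x, |P i x| ≤ c₀ * ‖x‖ ^ 2)
    (hpol : ∀ i x y, |QuadraticMap.polar (P i) x y| ≤ 2 * c₀ * ‖x‖ * ‖y‖) (hc0 : 0 ≤ c₀)
    (hC2 : 2 ≤ C) (hCc : 4 * c₀ * (m + 1) ^ 2 + 1 ≤ C) {A H : ℝ} (hA : 0 ≤ A)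
    (hH : H = (m + 1) * C + A)
    {j : Fin (m + 1)} {φ : (Fin m → ℝ) →ₗ[ℝ] ℝ} (hφ : ∀ x, |φ (Pi.single x 1)| ≤ 1) {r l : ℕ}
    (hl : scale l * (6 * c₀ * (m + 1) * H + c₀ * H ^ 2 + C + c₀ * C ^ 2) ≤ scale r)
    {s : Finset (CubeIndex (m + 1) (r + l))} (hs : IsPlanar A j φ s) {D : ℝ} (hD : 0 ≤ D)
    (hdec : DecouplesWith (fun x => (P x).comp (graphMap j φ)) C p r Finset.univ D)
    (f : CubeIndex (m + 1) (r + l) → Lp ℂ p (volume : Measure (Space (m + 1) n)))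
    (hf : ∀ i ∈ s, HasFourierSupportIn (f i) (uncertaintyBox P C i)) :
    ‖∑ i ∈ s, f i‖ ≤ D * (2 * (A + m + 1) + 1) *
      (∑ τ ∈ s.image parent, ‖∑ i ∈ s with parent i = τ, f i‖ ^ p.toReal) ^ (1 / p.toReal) := by
  have hp0 : 0 < p.toReal := ENNReal.toReal_pos (zero_lt_one.trans hp1).ne' hp
  have hC : 0 ≤ C := by linarith
  set T := s.image parent with hT
  set F : CubeIndex (m + 1) r → Lp ℂ p (volume : Measure (Space (m + 1) n)) :=
    fun τ => ∑ i ∈ s with parent i = τ, f i with hF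
  have hsum : ∑ i ∈ s, f i = ∑ τ ∈ T, F τ :=
    (Finset.sum_fiberwise_of_maps_to (fun i hi => Finset.mem_image_of_mem parent hi) f).symm
  rw [hsum]
  -- Ancestors with the same projection share one box of the restricted forms; the restricted
  -- decoupling separates the projections, and the triangle inequality the boundedly many ancestors
  -- over each.
  refine norm_sum_le_of_fiberwise T (dropIndex j) F hp0 hD (by positivity) ?_ ?_
  · obtain ⟨c, hcs⟩ := hs
    set π := shearLinear P (dropCoord j) (Pi.single j c) 1
    set η := shearConst P (dropCoord j) (Pi.single j c) 1
    have hcont : Continuous fun ξ => π ξ + η :=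
      (LinearMap.continuous_of_finiteDimensional π).add continuous_const
    have hsum' : ∑ τ ∈ T, F τ = ∑ e ∈ T.image (dropIndex j), ∑ τ ∈ T with dropIndex j τ = e, F τ :=
      (Finset.sum_fiberwise_of_maps_to
        (fun i hi => Finset.mem_image_of_mem (dropIndex j) hi) F).symm
    rw [hsum']
    refine decoupling_transfer π (shearLinear_surjective P (dropCoord_surjective j) _ one_ne_zero) η
      hp1 hp (T.image (dropIndex j))
      (fun e => uncertaintyBox (fun x => (P x).comp (graphMap j φ)) C e)
      (fun e _ => isClosed_uncertaintyBox _ C e) hD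
      (fun g hg => (hdec.subset hp0 (Finset.subset_univ _)).norm_sum_le g hg) _ ?_
    intro e _
    refine HasFourierSupportIn.sum ((isClosed_uncertaintyBox _ C e).preimage hcont) ?_
    intro τ hτ
    refine HasFourierSupportIn.sum ((isClosed_uncertaintyBox _ C e).preimage hcont) ?_
    intro i hi
    obtain ⟨his, rfl⟩ := Finset.mem_filter.1 hi
    obtain ⟨-, rfl⟩ := Finset.mem_filter.1 hτ
    exact (hf i his).mono fun ξ hξ =>
      shear_mem_uncertaintyBox hc hpol hc0 hC2 hCc hA hH hφ hl (hcs i his) hξ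
  · intro e _
    refine (norm_sum_le_card_mul _ F hp0).trans ?_
    exact mul_le_mul_of_nonneg_right (hs.card_fiber_le hA hφ e)
      (Real.rpow_nonneg (Finset.sum_nonneg fun i _ => by positivity) _)

theorem decouplesWith_of_decouplingConst_le {d : ℕ} {P : Fin n → QuadraticForm ℝ (Fin d → ℝ)}
    {C : ℝ} (hp : p ≠ ⊤) {k : ℕ} {A : ℝ} (h : decouplingConst P C p k ≤ A) :
    DecouplesWith P C p k Finset.univ A :=
  (decouplingConst_isLeast P C p hp k).1.2.mono h

/-- Finitely many scales are harmless in a decoupling estimate. -/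
theorem exists_decouplesWith_of_lt {d : ℕ} (P : Fin n → QuadraticForm ℝ (Fin d → ℝ))
    (C : ℝ) (hp0 : 0 < p.toReal) (a : ℝ) (k₀ : ℕ) :
    ∃ K : ℝ, 0 ≤ K ∧ ∀ k < k₀, ∀ s : Finset (CubeIndex d k),
      DecouplesWith P C p k s (K * scale k ^ a) := by
  have hpos : ∀ k, 0 < scale k ^ a := fun k => Real.rpow_pos_of_pos (scale_pos k) _
  have h0 : ∀ k, 0 ≤ (Fintype.card (CubeIndex d k) : ℝ) / scale k ^ a := fun k => by
    have := hpos k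
    positivity
  refine ⟨∑ k ∈ Finset.range k₀, (Fintype.card (CubeIndex d k) : ℝ) / scale k ^ a,
    Finset.sum_nonneg fun k _ => h0 k, fun k hk s => (decouplesWith_card hp0 s).mono ?_⟩
  rw [← div_le_iff₀ (hpos k)]
  refine le_trans ?_ (Finset.single_le_sum (fun k _ => h0 k) (Finset.mem_range.2 hk))
  have h1 : (s.card : ℝ) ≤ Fintype.card (CubeIndex d k) := by exact_mod_cast s.card_le_univ
  have := hpos k
  gcongr

/-- Lower-dimensional decoupling controls the small cubes near a hyperplane. -/
theorem exists_decouplesWith_of_isPlanar (hp1 : 1 < p) (hp : p ≠ ⊤)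
    {P : Fin n → QuadraticForm ℝ (Fin (m + 1) → ℝ)} {C c₀ : ℝ}
    (hc : ∀ i x, |P i x| ≤ c₀ * ‖x‖ ^ 2)
    (hpol : ∀ i x y, |QuadraticMap.polar (P i) x y| ≤ 2 * c₀ * ‖x‖ * ‖y‖) (hc0 : 0 ≤ c₀)
    (hC2 : 2 ≤ C) (hCc : 4 * c₀ * (m + 1) ^ 2 + 1 ≤ C) {A : ℝ} (hA : 0 ≤ A)
    (Λ : ℝ) {K : ℝ} (hK : 0 ≤ K) {ε : ℝ} (hε : 0 < ε) :
    ∃ K' : ℝ, 0 ≤ K' ∧ ∀ (j : Fin (m + 1)) (φ : (Fin m → ℝ) →ₗ[ℝ] ℝ),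
      (∀ x, |φ (Pi.single x 1)| ≤ 1) →
      (∀ k, decouplingConst (fun x => (P x).comp (graphMap j φ)) C p k ≤ K * scale k ^ (-Λ)) →
      ∀ (k : ℕ) (s : Finset (CubeIndex (m + 1) k)), IsPlanar A j φ s →
        DecouplesWith P C p k s (K' * scale k ^ (-Λ - ε)) := by
  have hp0 : 0 < p.toReal := ENNReal.toReal_pos (zero_lt_one.trans hp1).ne' hp
  have hC : 0 ≤ C := by linarith
  set H := (m + 1) * C + A with hH
  set B := 2 * (A + m + 1) + 1 with hB
  have hB0 : 0 ≤ B := by positivity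
  obtain ⟨R, hR⟩ := exists_mul_scale_rpow_le_one (K * B) hε
  -- `R ≤ r` lets `scale r ^ ε` absorb the loss `K * B` of one round, so the same `K'` serves at
  -- every scale; `1 ≤ r` makes the induction descend.
  obtain ⟨r, hr1, hRr⟩ : ∃ r, 1 ≤ r ∧ R ≤ r := ⟨R + 1, by omega, by omega⟩
  obtain ⟨N, hN⟩ := exists_scale_mul_le
    (6 * c₀ * (m + 1) * H + c₀ * H ^ 2 + C + c₀ * C ^ 2) (scale_pos r)
  obtain ⟨K', hK', hsmall⟩ := exists_decouplesWith_of_lt P C hp0 (-Λ - ε) (r + N)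
  refine ⟨K', hK', fun j φ hφ hdec k => ?_⟩
  induction k using Nat.strong_induction_on with
  | _ k ih =>
    intro s hs
    by_cases hk : k < r + N
    · exact hsmall k hk s
    push Not at hk
    obtain ⟨l, rfl⟩ := Nat.exists_eq_add_of_le (show r ≤ k by omega)
    have hNl : N ≤ l := by omega
    intro f hf
    have hr0 := scale_pos r
    have hl0 := scale_pos l
    have hDr : 0 ≤ K * scale r ^ (-Λ) := mul_nonneg hK (Real.rpow_nonneg hr0.le _)
    have hDl : 0 ≤ K' * scale l ^ (-Λ - ε) := mul_nonneg hK' (Real.rpow_nonneg hl0.le _)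
    have hcoarse := hs.norm_sum_le hp1 hp hc hpol hc0 hC2 hCc hA hH hφ (hN l hNl) hDr
      (decouplesWith_of_decouplingConst_le hp (hdec r)) f fun i _ => hf i
    have hmain := norm_sum_le_of_fiberwise s parent f hp0 (mul_nonneg hDr hB0) hDl hcoarse
      fun τ _ => by
        have hτ : ∀ i ∈ s.filter fun i => parent i = τ, parent i = τ :=
          fun i hi => (Finset.mem_filter.1 hi).2
        exact (ih l (by omega) _ (hs.image_relIndex (Finset.filter_subset _ _) hτ)
          ).norm_sum_le_of_parent_eq hp1 hp hC τ _ hτ hDl f fun i _ => hf i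
    refine hmain.trans (mul_le_mul_of_nonneg_right ?_
      (Real.rpow_nonneg (Finset.sum_nonneg fun i _ => by positivity) _))
    have h1 : K * B * scale r ^ ε ≤ 1 := hR r hRr
    have h2 : scale r ^ (-Λ) = scale r ^ (-Λ - ε) * scale r ^ ε := by
      rw [← Real.rpow_add hr0]; congr 1; ring
    rw [scale_add, Real.mul_rpow hr0.le hl0.le, h2]
    have h3 : 0 ≤ K' * (scale r ^ (-Λ - ε) * scale l ^ (-Λ - ε)) := by positivity
    calc K * (scale r ^ (-Λ - ε) * scale r ^ ε) * B * (K' * scale l ^ (-Λ - ε))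
        = (K * B * scale r ^ ε) * (K' * (scale r ^ (-Λ - ε) * scale l ^ (-Λ - ε))) := by ring
      _ ≤ 1 * (K' * (scale r ^ (-Λ - ε) * scale l ^ (-Λ - ε))) :=
          mul_le_mul_of_nonneg_right h1 h3
      _ = _ := one_mul _

end Planar

/-! ### Tangent plane approximation and induction on scale for `C²` graphs. -/

section Surfaces

/-- The mean value inequality is used twice: it makes the derivative `M`-Lipschitz on `Ω`, and then
bounds `L` minus its linear part on the convex set where `Ω` meets the ball of radius `‖x - x₀‖`.
The factor `1 / 2` of Taylor's formula is not needed. -/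
theorem abs_sub_tangent_le {E : Type*} [NormedAddCommGroup E] [NormedSpace ℝ E] {Ω : Set E}
    {L : E → ℝ} {M : ℝ} (hΩ : Convex ℝ Ω) (hi : (interior Ω).Nonempty) (hL : ContDiffOn ℝ 2 L Ω)
    (hM : ∀ x ∈ Ω, ‖iteratedFDerivWithin ℝ 2 L Ω x‖ ≤ M) {x₀ x : E} (hx₀ : x₀ ∈ Ω) (hx : x ∈ Ω) :
    |L x - L x₀ - fderivWithin ℝ L Ω x₀ (x - x₀)| ≤ M * ‖x - x₀‖ ^ 2 := by
  have hu : UniqueDiffOn ℝ Ω := uniqueDiffOn_convex hΩ hi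
  have hM0 : 0 ≤ M := (norm_nonneg _).trans (hM x₀ hx₀)
  have hd : ContDiffOn ℝ 1 (fderivWithin ℝ L Ω) Ω :=
    hL.fderivWithin hu (by norm_num)
  have h1 : ∀ y ∈ Ω, ‖fderivWithin ℝ L Ω y - fderivWithin ℝ L Ω x₀‖ ≤ M * ‖y - x₀‖ := by
    intro y hy
    refine hΩ.norm_image_sub_le_of_norm_fderivWithin_le (𝕜 := ℝ)
      (hd.differentiableOn one_ne_zero) (fun z hz => ?_) hx₀ hy
    have h2 := hM z hz
    rw [← norm_iteratedFDerivWithin_fderivWithin hu hz] at h2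
    rwa [← norm_iteratedFDerivWithin_one _ (hu z hz)]
  have hconv : Convex ℝ (Ω ∩ Metric.closedBall x₀ ‖x - x₀‖) :=
    hΩ.inter (convex_closedBall _ _)
  have h3 := hconv.norm_image_sub_le_of_norm_hasFDerivWithin_le' (𝕜 := ℝ) (f := L)
    (f' := fderivWithin ℝ L Ω) (φ := fderivWithin ℝ L Ω x₀) (C := M * ‖x - x₀‖)
    (fun y hy => ((hL.differentiableOn two_ne_zero y hy.1).hasFDerivWithinAt).mono
      inter_subset_left)
    (fun y hy => (h1 y hy.1).trans (by
      have := mem_closedBall_iff_norm.1 hy.2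
      gcongr))
    ⟨hx₀, Metric.mem_closedBall_self (norm_nonneg _)⟩
    ⟨hx, by rw [mem_closedBall_iff_norm]⟩
  rw [sq, ← mul_assoc]
  exact h3

variable {m n : ℕ}

theorem norm_toLp_le (y : Fin m → ℝ) : ‖(WithLp.toLp 2 y : EuclideanSpace ℝ (Fin m))‖ ≤ m * ‖y‖ := by
  rw [EuclideanSpace.norm_eq, Real.sqrt_le_left (by positivity)]
  have h1 : ∀ x, ‖y x‖ ^ 2 ≤ ‖y‖ ^ 2 := fun x => by
    gcongr
    exact norm_le_pi_norm y x
  refine (Finset.sum_le_card_nsmul _ _ _ fun x _ => h1 x).trans ?_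
  rw [Finset.card_univ, Fintype.card_fin, nsmul_eq_mul, mul_pow]
  have h2 : (m : ℝ) ≤ (m : ℝ) ^ 2 := by exact_mod_cast Nat.le_self_pow two_ne_zero m
  gcongr

/-- The linear form that cuts out the tangent hyperplane of a graph `t_d = L(t')` where the
derivative of `L` is `T`. -/
def tangentForm (T : EuclideanSpace ℝ (Fin m) →L[ℝ] ℝ) : (Fin (m + 1) → ℝ) →ₗ[ℝ] ℝ :=
  LinearMap.proj (Fin.last m) -
    T.toLinearMap ∘ₗ (WithLp.linearEquiv 2 ℝ (Fin m → ℝ)).symm.toLinearMap ∘ₗ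
      LinearMap.funLeft ℝ ℝ Fin.castSucc

theorem tangentForm_apply (T : EuclideanSpace ℝ (Fin m) →L[ℝ] ℝ) (t : Fin (m + 1) → ℝ) :
    tangentForm T t = t (Fin.last m) - T (WithLp.toLp 2 (Fin.init t : Fin m → ℝ)) := rfl

theorem norm_init_le (t : Fin (m + 1) → ℝ) : ‖(Fin.init t : Fin m → ℝ)‖ ≤ ‖t‖ :=
  (pi_norm_le_iff_of_nonneg (norm_nonneg _)).2 fun _ => norm_le_pi_norm t _

theorem abs_tangentForm_le {T : EuclideanSpace ℝ (Fin m) →L[ℝ] ℝ} {M : ℝ} (hT : ‖T‖ ≤ M)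
    (t : Fin (m + 1) → ℝ) : |tangentForm T t| ≤ (1 + M * m) * ‖t‖ := by
  rw [tangentForm_apply]
  have h1 : |t (Fin.last m)| ≤ ‖t‖ := norm_le_pi_norm t _
  have hM : 0 ≤ M := (norm_nonneg _).trans hT
  have h2 : |T (WithLp.toLp 2 (Fin.init t : Fin m → ℝ))| ≤ M * (m * ‖t‖) := by
    refine (T.le_opNorm _).trans ?_
    have h3 := (norm_toLp_le (Fin.init t : Fin m → ℝ))
    have h4 := norm_init_le t
    have h5 : (m : ℝ) * ‖(Fin.init t : Fin m → ℝ)‖ ≤ m * ‖t‖ := by gcongr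
    exact mul_le_mul hT (h3.trans h5) (norm_nonneg _) hM
  have h6 := abs_sub (t (Fin.last m)) (T (WithLp.toLp 2 (Fin.init t : Fin m → ℝ)))
  linarith

theorem tangentForm_single_last (T : EuclideanSpace ℝ (Fin m) →L[ℝ] ℝ) :
    tangentForm T (Pi.single (Fin.last m) 1) = 1 := by
  have h : (Fin.init (Pi.single (Fin.last m) 1 : Fin (m + 1) → ℝ) : Fin m → ℝ) = 0 := by
    ext x
    simp [Fin.init, Fin.castSucc_ne_last]
  rw [tangentForm_apply, h]
  simp

/-- The surface is a graph in the last coordinate, while the hypothesis may present its tangent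
plane in another one. Both forms vanish on that plane, so `F` is `F (Pi.single j 1)` times the
height. Evaluation at the last unit vector, whose height is at most `1` because `φ` has coefficients
in `[-1, 1]`, shows that this factor is at least `1` in absolute value. -/
theorem abs_height_le_abs {F : (Fin (m + 1) → ℝ) →ₗ[ℝ] ℝ}
    (hF : F (Pi.single (Fin.last m) 1) = 1) {j : Fin (m + 1)} {φ : (Fin m → ℝ) →ₗ[ℝ] ℝ}
    (hφ : ∀ x, |φ (Pi.single x 1)| ≤ 1)
    (hr : LinearMap.range (graphMap j φ) = LinearMap.ker F) (t : Fin (m + 1) → ℝ) :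
    |height j φ t| ≤ |F t| := by
  have h1 : ∀ t, F t = height j φ t * F (Pi.single j 1) := by
    intro t
    have h2 : F (graphMap j φ (dropCoord j t)) = 0 := by
      have : graphMap j φ (dropCoord j t) ∈ LinearMap.ker F := hr ▸ LinearMap.mem_range_self _ _
      exact this
    conv_lhs => rw [eq_graphMap_add_single j φ t]
    rw [map_add, h2, zero_add, map_smul, smul_eq_mul, height_apply]
  have h3 : |height j φ (Pi.single (Fin.last m) 1)| ≤ 1 := by
    rw [height_apply]
    rcases Fin.eq_self_or_eq_succAbove j (Fin.last m) with h | ⟨y, h⟩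
    · rw [h, dropCoord_single]; simp
    · rw [h]
      have h4 : dropCoord j (Pi.single (j.succAbove y) (1 : ℝ)) = Pi.single y 1 := by
        ext x
        simp [dropCoord_apply, Pi.single_apply]
      rw [h4, Pi.single_eq_of_ne (Fin.succAbove_ne j y).symm, zero_sub, abs_neg]
      exact hφ y
  have h5 : 1 ≤ |F (Pi.single j 1)| := by
    have h6 := h1 (Pi.single (Fin.last m) 1)
    rw [hF] at h6
    have h7 : 1 = |height j φ (Pi.single (Fin.last m) 1)| * |F (Pi.single j 1)| := by
      rw [← abs_mul, ← h6, abs_one]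
    nlinarith [abs_nonneg (F (Pi.single j 1))]
  rw [h1 t, abs_mul]
  exact le_mul_of_one_le_right (abs_nonneg _) h5

theorem norm_sub_le_of_mem_cube {d k : ℕ} {i : CubeIndex d k} {x y : Fin d → ℝ} (hx : x ∈ cube i)
    (hy : y ∈ cube i) : ‖x - y‖ ≤ scale k := by
  rw [pi_norm_le_iff_of_nonneg (scale_pos k).le]
  intro l
  have h1 := hx.1 l
  have h2 := hx.2 l
  have h3 := hy.1 l
  have h4 := hy.2 l
  rw [Pi.sub_apply, Real.norm_eq_abs, abs_le]
  constructor <;> linarith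

theorem corner_mem_cube {d k : ℕ} (i : CubeIndex d k) : corner i ∈ cube i :=
  ⟨le_rfl, fun _ => le_add_of_nonneg_right (scale_pos k).le⟩

/-- Inside a cube of side length `σ`, the cubes of side length at least `σ²` that meet a `C²` graph
are close to a hyperplane. -/
theorem IsC2Graph.exists_isPlanar {M : ℝ} {S : Set (Fin (m + 1) → ℝ)} (hS : IsC2Graph M S)
    {r l : ℕ} (hlr : l ≤ r) {s : Finset (CubeIndex (m + 1) (r + l))}
    (hs : s ⊆ cubesMeeting (r + l) S) {τ : CubeIndex (m + 1) r} (hτ : ∀ i ∈ s, parent i = τ)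
    (hne : s.Nonempty) {Q : Fin (m + 1) → ((Fin m → ℝ) →ₗ[ℝ] ℝ) → Prop}
    (hQ : ∀ H : Submodule ℝ (Fin (m + 1) → ℝ), Module.finrank ℝ H = m →
      ∃ (j : Fin (m + 1)) (φ : (Fin m → ℝ) →ₗ[ℝ] ℝ),
        (∀ x, |φ (Pi.single x 1)| ≤ 1) ∧ LinearMap.range (graphMap j φ) = H ∧ Q j φ) :
    ∃ (j : Fin (m + 1)) (φ : (Fin m → ℝ) →ₗ[ℝ] ℝ),
      (∀ x, |φ (Pi.single x 1)| ≤ 1) ∧ Q j φ ∧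
        IsPlanar (|M| * m ^ 2 + (1 + |M| * m)) j φ s := by
  classical
  obtain ⟨Ω, L, hΩ, hΩi, hL, hM, hgr⟩ := hS
  have hpt : ∀ i ∈ s, ∃ x, x ∈ cube i ∧ x ∈ S := fun i hi => by
    have := hs hi
    rw [cubesMeeting, Finset.mem_filter] at this
    exact this.2
  obtain ⟨i₀, hi₀⟩ := hne
  obtain ⟨x₀, hx₀c, hx₀S⟩ := hpt i₀ hi₀
  have hx₀ := hgr x₀ hx₀S
  -- The reference plane is tangent at an arbitrary point `x₀` of the surface inside `τ`, and the
  -- offset is the height of `x₀`.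
  set T := fderivWithin ℝ L Ω (WithLp.toLp 2 (Fin.init x₀ : Fin m → ℝ)) with hT
  have hTM : ‖T‖ ≤ |M| := by
    have h1 := hM _ hx₀.1 1 (by norm_num)
    rw [norm_iteratedFDerivWithin_one _ (uniqueDiffOn_convex hΩ hΩi _ hx₀.1)] at h1
    exact h1.trans (le_abs_self M)
  have hne0 : tangentForm T ≠ 0 := fun h => by
    have := tangentForm_single_last T
    rw [h] at this
    simp at this
  have hfin : Module.finrank ℝ (LinearMap.ker (tangentForm T)) = m := by
    have := Module.Dual.finrank_ker_add_one_of_ne_zero (f := tangentForm T) hne0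
    rw [Module.finrank_fin_fun] at this
    omega
  obtain ⟨j, φ, hφ, hrange, hQj⟩ := hQ _ hfin
  refine ⟨j, φ, hφ, hQj, height j φ x₀, fun i hi => ?_⟩
  obtain ⟨x, hxc, hxS⟩ := hpt i hi
  have hx := hgr x hxS
  rw [← map_sub]
  refine (abs_height_le_abs (tangentForm_single_last T) hφ hrange _).trans ?_
  have h1 : corner i - x₀ = (corner i - x) + (x - x₀) := by abel
  rw [h1, map_add]
  refine (abs_add_le _ _).trans ?_
  have h2 : |tangentForm T (corner i - x)| ≤ (1 + |M| * m) * scale (r + l) := by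
    refine (abs_tangentForm_le hTM _).trans ?_
    have := norm_sub_le_of_mem_cube (corner_mem_cube i) hxc
    gcongr
  have h3 : |tangentForm T (x - x₀)| ≤ |M| * m ^ 2 * scale (r + l) := by
    have hinit : (WithLp.toLp 2 (Fin.init (x - x₀) : Fin m → ℝ) : EuclideanSpace ℝ (Fin m))
        = WithLp.toLp 2 (Fin.init x : Fin m → ℝ) - WithLp.toLp 2 (Fin.init x₀ : Fin m → ℝ) := rfl
    have h4 := abs_sub_tangent_le hΩ hΩi hL (fun y hy => hM y hy 2 le_rfl) hx₀.1 hx.1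
    rw [tangentForm_apply, hinit, Pi.sub_apply, hx.2, hx₀.2]
    refine h4.trans ?_
    have h5 : ‖(WithLp.toLp 2 (Fin.init x : Fin m → ℝ) - WithLp.toLp 2 (Fin.init x₀ : Fin m → ℝ) :
        EuclideanSpace ℝ (Fin m))‖ ≤ m * scale r := by
      rw [← hinit]
      refine (norm_toLp_le _).trans ?_
      have h6 := norm_init_le (x - x₀)
      have hxτ : x ∈ cube τ := hτ i hi ▸ cube_subset_cube_parent i hxc
      have hx₀τ : x₀ ∈ cube τ := hτ i₀ hi₀ ▸ cube_subset_cube_parent i₀ hx₀c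
      have h7 := h6.trans (norm_sub_le_of_mem_cube hxτ hx₀τ)
      gcongr
    -- This is where `l ≤ r` enters: the tangent plane error is no larger than the side of the small
    -- cubes.
    have h8 : scale r ^ 2 ≤ scale (r + l) := by
      rw [scale_add, sq]
      exact mul_le_mul_of_nonneg_left (scale_anti hlr) (scale_pos r).le
    calc M * _ ≤ |M| * (m * scale r) ^ 2 := by
          gcongr
          exact le_abs_self M
      _ = |M| * m ^ 2 * scale r ^ 2 := by ring
      _ ≤ _ := by gcongr
  linarith

theorem image_parent_cubesMeeting_subset {d r l : ℕ} (S : Set (Fin d → ℝ)) :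
    (cubesMeeting (r + l) S).image parent ⊆ cubesMeeting r S := by
  classical
  intro τ hτ
  obtain ⟨i, hi, rfl⟩ := Finset.mem_image.1 hτ
  rw [cubesMeeting, Finset.mem_filter] at hi ⊢
  exact ⟨Finset.mem_univ _, hi.2.mono (inter_subset_inter_left S (cube_subset_cube_parent i))⟩

/-- Lower-dimensional decoupling controls the small cubes near a hypersurface. -/
theorem LowerDimDecoupling.exists_decouplesWith_cubesMeeting {p : ℝ≥0∞} [Fact (1 ≤ p)]
    (hp1 : 1 < p) (hp : p ≠ ⊤)
    {P : Fin n → QuadraticForm ℝ (Fin (m + 1) → ℝ)} {C c₀ : ℝ}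
    (hc : ∀ i x, |P i x| ≤ c₀ * ‖x‖ ^ 2)
    (hpol : ∀ i x y, |QuadraticMap.polar (P i) x y| ≤ 2 * c₀ * ‖x‖ * ‖y‖) (hc0 : 0 ≤ c₀)
    (hC2 : 2 ≤ C) (hCc : 4 * c₀ * (m + 1) ^ 2 + 1 ≤ C) {Λ : ℝ} (h : LowerDimDecoupling P C p Λ)
    {ε : ℝ} (hε : 0 < ε) (M : ℝ) :
    ∃ K : ℝ, ∀ S : Set (Fin (m + 1) → ℝ), IsC2Graph M S →
      ∀ k, DecouplesWith P C p k (cubesMeeting k S) (K * scale k ^ (-Λ - ε)) := by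
  have hp0 : 0 < p.toReal := ENNReal.toReal_pos (zero_lt_one.trans hp1).ne' hp
  have hC : 0 ≤ C := by linarith
  have hCc' : 4 * c₀ + 1 ≤ C := by
    have hm : (1 : ℝ) ≤ (m + 1) ^ 2 := one_le_pow₀ (by simp)
    nlinarith
  obtain ⟨K₀, hK₀⟩ := h
  -- Half of `ε` is spent on planar families, and the other half will absorb `K'`. The value of `A`
  -- is the one produced by `IsC2Graph.exists_isPlanar`.
  obtain ⟨K', hK', hplanar⟩ := exists_decouplesWith_of_isPlanar hp1 hp hc hpol hc0 hC2 hCc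
    (A := |M| * m ^ 2 + (1 + |M| * m)) (by positivity) Λ (le_max_right K₀ 0) (half_pos hε)
  obtain ⟨N₁, hN₁⟩ := exists_mul_scale_rpow_le_one K' (half_pos hε)
  obtain ⟨N₂, hN₂⟩ := exists_scale_mul_le (C + c₀ * C ^ 2) one_pos
  -- The step length `l` is fixed once: `N₁ ≤ l` absorbs `K'`, `N₂ ≤ l` nests the boxes in those of
  -- their ancestors, and `1 ≤ l` makes the induction descend. Scales `k < l + l` are treated
  -- trivially, so that `r = k - l ≥ l` otherwise.
  obtain ⟨l, hl1, hlN₁, hlN₂⟩ : ∃ l, 1 ≤ l ∧ N₁ ≤ l ∧ N₂ ≤ l :=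
    ⟨N₁ + N₂ + 1, by omega, by omega, by omega⟩
  obtain ⟨K, hK, hsmall⟩ := exists_decouplesWith_of_lt P C hp0 (-Λ - ε) (l + l)
  refine ⟨K, fun S hS k => ?_⟩
  induction k using Nat.strong_induction_on with
  | _ k ih =>
    by_cases hk : k < l + l
    · exact hsmall k hk _
    push Not at hk
    obtain ⟨r, rfl⟩ := Nat.exists_eq_add_of_le' (show l ≤ k by omega)
    have hlr : l ≤ r := by omega
    intro f hf
    have hr0 := scale_pos r
    have hl0 := scale_pos l
    have hDr : 0 ≤ K * scale r ^ (-Λ - ε) := mul_nonneg hK (Real.rpow_nonneg hr0.le _)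
    have hDl : 0 ≤ K' * scale l ^ (-Λ - ε / 2) := mul_nonneg hK' (Real.rpow_nonneg hl0.le _)
    set s := cubesMeeting (r + l) S with hs
    have hcoarse := ((ih r (by omega)).subset hp0 (image_parent_cubesMeeting_subset (l := l) S)).norm_sum_le
      (fun τ => ∑ i ∈ s with parent i = τ, f i) fun τ _ => by
        refine HasFourierSupportIn.sum (isClosed_uncertaintyBox P C τ) fun i hi => ?_
        obtain ⟨-, rfl⟩ := Finset.mem_filter.1 hi
        exact (hf i).mono (uncertaintyBox_subset_parent hc hc0 hC2 hCc' (hN₂ l hlN₂) i)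
    rw [Finset.sum_fiberwise_of_maps_to fun i hi => Finset.mem_image_of_mem parent hi] at hcoarse
    have hmain := norm_sum_le_of_fiberwise s parent f hp0 hDr hDl hcoarse fun τ hτ => by
      have hτ' : ∀ i ∈ s.filter fun i => parent i = τ, parent i = τ :=
        fun i hi => (Finset.mem_filter.1 hi).2
      have hne : (s.filter fun i => parent i = τ).Nonempty := by
        obtain ⟨i, hi, hiτ⟩ := Finset.mem_image.1 hτ
        exact ⟨i, Finset.mem_filter.2 ⟨hi, hiτ⟩⟩
      obtain ⟨j, φ, hφ, hdec, hpl⟩ := hS.exists_isPlanar hlr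
        (s := s.filter fun i => parent i = τ) (Finset.filter_subset _ _) hτ' hne hK₀
      refine (hplanar j φ hφ (fun k => (hdec k).trans ?_) l _
        (hpl.image_relIndex subset_rfl hτ')).norm_sum_le_of_parent_eq hp1 hp hC τ _ hτ' hDl f
          fun i _ => hf i
      exact mul_le_mul_of_nonneg_right (le_max_left _ _) (Real.rpow_nonneg (scale_pos k).le _)
    refine hmain.trans (mul_le_mul_of_nonneg_right ?_
      (Real.rpow_nonneg (Finset.sum_nonneg fun i _ => by positivity) _))
    have h1 : K' * scale l ^ (ε / 2) ≤ 1 := hN₁ l hlN₁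
    have h2 : scale l ^ (-Λ - ε / 2) = scale l ^ (-Λ - ε) * scale l ^ (ε / 2) := by
      rw [← Real.rpow_add hl0]; congr 1; ring
    rw [scale_add, Real.mul_rpow hr0.le hl0.le, h2]
    have h3 : 0 ≤ K * (scale r ^ (-Λ - ε) * scale l ^ (-Λ - ε)) := by positivity
    calc K * scale r ^ (-Λ - ε) * (K' * (scale l ^ (-Λ - ε) * scale l ^ (ε / 2)))
        = (K' * scale l ^ (ε / 2)) * (K * (scale r ^ (-Λ - ε) * scale l ^ (-Λ - ε))) := by ring
      _ ≤ 1 * (K * (scale r ^ (-Λ - ε) * scale l ^ (-Λ - ε))) :=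
          mul_le_mul_of_nonneg_right h1 h3
      _ = _ := one_mul _

end Surfaces

end QuadDecoupling

end


theorem mainTheorem6 {m n : ℕ} (hn : 1 ≤ n) (hnd : n ≤ m + 1)
    (P : Fin n → QuadraticForm ℝ (Fin (m + 1) → ℝ)) :
    ∃ C₀ : ℝ, ∀ C : ℝ, C₀ ≤ C →
      ∀ (p : ℝ≥0∞) [Fact (1 ≤ p)], 2 ≤ p → p < ⊤ →
        ∀ Λ : ℝ, QuadDecoupling.LowerDimDecoupling P C p Λ →
          ∀ ε : ℝ, 0 < ε → ∀ M : ℝ,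
            ∃ K : ℝ, ∀ S : Set (Fin (m + 1) → ℝ), S ⊆ Set.Icc 0 1 →
              QuadDecoupling.IsC2Graph M S →
                ∀ k : ℕ, QuadDecoupling.DecouplesWith P C p k (QuadDecoupling.cubesMeeting k S)
                  (K * QuadDecoupling.scale k ^ (-Λ - ε)) := by
  obtain ⟨c₀, hc0, hc, hpol⟩ := QuadDecoupling.exists_quadraticForm_bound P
  -- Frequencies of a small cube lie within `2 * scale r` of the ancestor's corner, hence the `2`.
  -- The second bound is vertical: `4 * c₀ * (m + 1) ^ 2` for the restricted form at that
  -- displacement, and `1` for all smaller errors.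
  refine ⟨max 2 (4 * c₀ * (m + 1) ^ 2 + 1), fun C hC p _ hp2 hp Λ h ε hε M => ?_⟩
  obtain ⟨K, hK⟩ := h.exists_decouplesWith_cubesMeeting (ENNReal.one_lt_two.trans_le hp2) hp.ne hc hpol hc0
    ((le_max_left _ _).trans hC) ((le_max_right _ _).trans hC) hε M
  exact ⟨K, fun S _ hS k => hK S hS k⟩
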